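/- **The game.** Let $K,L,A,B$ be non-empty finite sets, $p\in\Delta(K)$, $q\in\Delta(L)$, $n\ge 1$ an integer and $\lambda\in(0,1]$. For all $a\in A$, $b\in B$ let $P_{a,b}$ and $Q_{a,b}$ be row-stochastic matrices on $K$ and $L$, and for $k\in K$, $l\in L$ let $G_{k,l}(a,b)\ge 0$. In the primal game $\Gamma_{n,\lambda}(p,q)$ the initial states $k_1\sim p$ and $l_1\sim q$ are drawn independently; at each stage $t=1,\dots,n$ the players, knowing respectively $\mathcal I_t=(k_1,a_1,b_1,\dots,k_{t-1},a_{t-1},b_{t-1},k_t)$ and $\mathcal J_t=(l_1,a_1,b_1,\dots,l_{t-1},a_{t-1},b_{t-1},l_t)$, simultaneously choose actions $a_t\in A$, $b_t\in B$, both of which become publicly known; then $k_{t+1}\sim P_{a_t,b_t}(k_t,\cdot)$ and $l_{t+1}\sim Q_{a_t,b_t}(l_t,\cdot)$ independently. Behavior strategies are $\sigma=(\sigma_t)$, $\sigma_t(\mathcal I_t)\in\Delta(A)$, for player 1 and $\tau=(\tau_t)$, $\tau_t(\mathcal J_t)\in\Delta(B)$, for player 2. Player 1 maximizes and player 2 minimizes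 $$\gamma(p,q,\sigma,\tau)=E_{p,q,\sigma,\tau}\Big[\sum_{t=1}^n\lambda^{t-1}G_{k_t,l_t}(a_t,b_t)\Big].$$ A game has a value if its maxmin and its minmax exist (all extrema being attained) and are equal. A security strategy of player 1 (player 2) is one that guarantees the maxmin (minmax). Put $$\alpha_l(\sigma)=\min_\tau E_{p,q,\sigma,\tau}\Big[\sum_{t=1}^n\lambda^{t-1}G_{k_t,l_t}(a_t,b_t)\,\Big|\,l_1=l\Big],\qquad \beta_k(\tau)=\max_\sigma E_{p,q,\sigma,\tau}\Big[\sum_{t=1}^n\lambda^{t-1}G_{k_t,l_t}(a_t,b_t)\,\Big|\,k_1=k\Big],$$ where conditioning on $l_1=l$ (on $k_1=k$) means that the play starts with $l_1=l$ (with $k_1=k$); this makes sense also if $q(l)=0$ (if $p(k)=0$). **Dual games.** For $\nu\in\mathbb R^L$, the type 2 dual game is the same game, except that player 2 also chooses the distribution $q'\in\Delta(L)$ of its initial state and that the payoff is $E_{p,q',\sigma,\tau}[\nu(l_1)+\sum_{t=1}^n\lambda^{t-1}G_{k_t,l_t}(a_t,b_t)]$; its value is $w^2(p,\nu)$. For $\mu\in\mathbb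 R^K$, the type 1 dual game is the same game, except that player 1 also chooses the distribution $p'\in\Delta(K)$ of its initial state and that the payoff is $E_{p',q,\sigma,\tau}[\mu(k_1)+\sum_{t=1}^n\lambda^{t-1}G_{k_t,l_t}(a_t,b_t)]$; its value is $w^1(\mu,q)$. **Conventions.** Put $P_{a_0,b_0}(k_0,k_1)R_{\mathcal I_0}(a_0):=p(k_1)$ and $Q_{a_0,b_0}(l_0,l_1)S_{\mathcal J_0}(b_0):=q(l_1)$. **Theorem.** The game $\Gamma_{n,\lambda}(p,q)$ has a value $v=v_{n,\lambda}(p,q)$, the dual games have values for all $\nu$ and $\mu$, and the following holds. (1) $v$ is the (attained) maximum of $\sum_l q(l)U_{\mathcal J_1}$, $\mathcal J_1=\{l\}$, over real variables $R_{\mathcal I_t}(a_t)$ ($1\le t\le n$) and $U_{\mathcal J_t}$ ($1\le t\le n+1$) subject to $$\sum_{k_1,\dots,k_t}\sum_{a_t}R_{\mathcal I_t}(a_t)\lambda^{t-1}G_{k_t,l_t}(a_t,b_t)+\sum_{l_{t+1}}\sum_{a_t}Q_{a_t,b_t}(l_t,l_{t+1})U_{\mathcal J_{t+1}}\ \ge\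 U_{\mathcal J_t}\qquad(1\le t\le n,\ \text{all }b_t,\mathcal J_t),$$ $$\sum_{a_t}R_{\mathcal I_t}(a_t)=P_{a_{t-1},b_{t-1}}(k_{t-1},k_t)R_{\mathcal I_{t-1}}(a_{t-1})\quad(1\le t\le n,\ \text{all }\mathcal I_t),\qquad U_{\mathcal J_{n+1}}=0,\qquad R_{\mathcal I_t}(a_t)\ge 0 .$$ In the first constraint $\mathcal I_t$ consists of $k_1,\dots,k_t$ and the actions in $\mathcal J_t$, and $\mathcal J_{t+1}=(\mathcal J_t,a_t,b_t,l_{t+1})$. Let $(R^*,U^*)$ be any optimal solution. There are strategies $\sigma^*$ of player 1 with $$\sigma^{*}_t(\mathcal I_t)(a_t)=\frac{R^*_{\mathcal I_t}(a_t)}{P_{a_{t-1},b_{t-1}}(k_{t-1},k_t)R^*_{\mathcal I_{t-1}}(a_{t-1})}$$ wherever the denominator is non-zero (elsewhere $\sigma^*_t(\mathcal I_t)\in\Delta(A)$ is arbitrary). Every such $\sigma^*$ is a security strategy of player 1. For all $l$, $U^*_{\mathcal J_1}\le\alpha_l(\sigma^*)$ where $\mathcal J_1=\{l\}$, with equality if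 $q(l)>0$; and there is an optimal solution $(R^*,U')$ with the same $R^*$ and with $U'_{\mathcal J_1}=\alpha_l(\sigma^*)$ for all $l$. The vector $\nu^*_l=-U^*_{\mathcal J_1}$ (so $\nu^*_l=-\alpha_l(\sigma^*)$ if $q(l)>0$) is an optimal initial vector payoff of the type 2 dual game: it attains the maximum in $v=\max_{\nu\in\mathbb R^L}\big(w^2(p,\nu)-\sum_l q(l)\nu_l\big)$. (2) Symmetrically, $v$ is the (attained) minimum of $\sum_k p(k)Z_{\mathcal I_1}$, $\mathcal I_1=\{k\}$, over real variables $S_{\mathcal J_t}(b_t)$ ($1\le t\le n$) and $Z_{\mathcal I_t}$ ($1\le t\le n+1$) subject to $$\sum_{l_1,\dots,l_t}\sum_{b_t}S_{\mathcal J_t}(b_t)\lambda^{t-1}G_{k_t,l_t}(a_t,b_t)+\sum_{k_{t+1}}\sum_{b_t}P_{a_t,b_t}(k_t,k_{t+1})Z_{\mathcal I_{t+1}}\ \le\ Z_{\mathcal I_t}\qquad(1\le t\le n,\ \text{all }a_t,\mathcal I_t),$$ $$\sum_{b_t}S_{\mathcal J_t}(b_t)=Q_{a_{t-1},b_{t-1}}(l_{t-1},l_t)S_{\mathcal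 J_{t-1}}(b_{t-1})\quad(1\le t\le n,\ \text{all }\mathcal J_t),\qquad Z_{\mathcal I_{n+1}}=0,\qquad S_{\mathcal J_t}(b_t)\ge 0 .$$ In the first constraint $\mathcal J_t$ consists of $l_1,\dots,l_t$ and the actions in $\mathcal I_t$, and $\mathcal I_{t+1}=(\mathcal I_t,a_t,b_t,k_{t+1})$. Let $(S^*,Z^*)$ be any optimal solution. There are strategies $\tau^*$ of player 2 with $$\tau^{*}_t(\mathcal J_t)(b_t)=\frac{S^*_{\mathcal J_t}(b_t)}{Q_{a_{t-1},b_{t-1}}(l_{t-1},l_t)S^*_{\mathcal J_{t-1}}(b_{t-1})}$$ wherever the denominator is non-zero (elsewhere $\tau^*_t(\mathcal J_t)\in\Delta(B)$ is arbitrary). Every such $\tau^*$ is a security strategy of player 2. For all $k$, $Z^*_{\mathcal I_1}\ge\beta_k(\tau^*)$ where $\mathcal I_1=\{k\}$, with equality if $p(k)>0$; and there is an optimal solution $(S^*,Z')$ with the same $S^*$ and with $Z'_{\mathcal I_1}=\beta_k(\tau^*)$ for all $k$. The vector $\mu^*_k=-Z^*_{\mathcal I_1}$ (so $\mu^*_k=-\beta_k(\tau^*)$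 if $p(k)>0$) is an optimal initial vector payoff of the type 1 dual game: it attains the minimum in $v=\min_{\mu\in\mathbb R^K}\big(w^1(\mu,q)-\sum_k p(k)\mu_k\big)$. -/

import Mathlib

open scoped BigOperators

noncomputable section

namespace BayesGame

/-! ## The game -/

/-- The data of a two-player zero-sum stochastic game with incomplete information on both sides
(the initial distributions `p`, `q`, the horizon `n` and the discount factor are given separately).
`P a b k k'` is the probability that player 1's next state is `k'` when its current state is `k`
and the current actions are `a`, `b`; similarly `Q a b l l'` for player 2. `G k l a b` is the
one-stage payoff to player 1, which is the one-stage cost of player 2. -/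
structure Game (K L A B : Type*) [Fintype K] [Fintype L] where
  P : A → B → K → K → ℝ
  Q : A → B → L → L → ℝ
  G : K → L → A → B → ℝ
  P_mem : ∀ a b k, P a b k ∈ stdSimplex ℝ K
  Q_mem : ∀ a b l, Q a b l ∈ stdSimplex ℝ L
  G_nonneg : ∀ k l a b, 0 ≤ G k l a b

/-- The information of a player with state set `S` just before acting, after `t` stages have been
played: its own states `s_0, …, s_t` and the actions `a_0, b_0, …, a_{t-1}, b_{t-1}` of both
players. Stages are numbered from `0`. -/
structure Info (S A B : Type*) (t : ℕ) where
  st : Fin (t + 1) → S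
  a : Fin t → A
  b : Fin t → B

namespace Info

variable {S A B : Type*}

/-- The information at the first stage: only the initial state. -/
def start (s : S) : Info S A B 0 := ⟨fun _ => s, Fin.elim0, Fin.elim0⟩

/-- The current (last) state. -/
def cur {t : ℕ} (I : Info S A B t) : S := I.st (Fin.last t)

/-- The information one stage later, after the actions `a`, `b` and the new state `s`. -/
def extend {t : ℕ} (I : Info S A B t) (a : A) (b : B) (s : S) : Info S A B (t + 1) :=
  ⟨Fin.snoc (α := fun _ => S) I.st s, Fin.snoc (α := fun _ => A) I.a a,
    Fin.snoc (α := fun _ => B) I.b b⟩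

/-- The information one stage earlier. -/
def prev {t : ℕ} (I : Info S A B (t + 1)) : Info S A B t :=
  ⟨fun i => I.st i.castSucc, fun i => I.a i.castSucc, fun i => I.b i.castSucc⟩

/-- Player 1's action at the most recent stage. -/
def lastA {t : ℕ} (I : Info S A B (t + 1)) : A := I.a (Fin.last t)

/-- Player 2's action at the most recent stage. -/
def lastB {t : ℕ} (I : Info S A B (t + 1)) : B := I.b (Fin.last t)

/-- The part of the information that was available at the earlier stage `t`. -/
def upTo {n : ℕ} (I : Info S A B n) (t : ℕ) (h : t ≤ n) : Info S A B t :=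
  ⟨fun i => I.st (Fin.castLE (Nat.succ_le_succ h) i), fun i => I.a (Fin.castLE h i),
    fun i => I.b (Fin.castLE h i)⟩

end Info

/-- Behavior strategies of a player with state set `S` and action set `C` (`C = A` for player 1,
`C = B` for player 2): a distribution on `C` for each stage and each information at that stage.
In an `n`-stage game only the components at the stages `0, …, n - 1` are used. -/
abbrev Strategy (S A B C : Type*) [Fintype C] : Type _ :=
  ∀ t : ℕ, Info S A B t → stdSimplex ℝ C

/-- A play of `n` stages: the states of player 1, the states of player 2 (both including the state
reached after the last stage, which is irrelevant for the payoff), the actions of player 1 and the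
actions of player 2. -/
abbrev Play (K L A B : Type*) (n : ℕ) : Type _ :=
  (Fin (n + 1) → K) × (Fin (n + 1) → L) × (Fin n → A) × (Fin n → B)

namespace Play

variable {K L A B : Type*} {n : ℕ}

def k (ω : Play K L A B n) : Fin (n + 1) → K := ω.1

def l (ω : Play K L A B n) : Fin (n + 1) → L := ω.2.1

def a (ω : Play K L A B n) : Fin n → A := ω.2.2.1

def b (ω : Play K L A B n) : Fin n → B := ω.2.2.2

/-- What player 1 knows at stage `t` of the play. -/
def info1 (ω : Play K L A B n) (t : Fin n) : Info K A B t :=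
  Info.upTo ⟨ω.k, ω.a, ω.b⟩ t t.is_lt.le

/-- What player 2 knows at stage `t` of the play. -/
def info2 (ω : Play K L A B n) (t : Fin n) : Info L A B t :=
  Info.upTo ⟨ω.l, ω.a, ω.b⟩ t t.is_lt.le

/-- A play of `n + 1` stages is a play of `n` stages followed by actions and new states. -/
def snocEquiv (K L A B : Type*) (n : ℕ) :
    (Play K L A B n) × ((K × L) × (A × B)) ≃ Play K L A B (n + 1) where
  toFun x := (Fin.snoc (α := fun _ => K) x.1.k x.2.1.1, Fin.snoc (α := fun _ => L) x.1.l x.2.1.2,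
    Fin.snoc (α := fun _ => A) x.1.a x.2.2.1, Fin.snoc (α := fun _ => B) x.1.b x.2.2.2)
  invFun ω := ((Fin.init (α := fun _ => K) ω.k, Fin.init (α := fun _ => L) ω.l,
      Fin.init (α := fun _ => A) ω.a, Fin.init (α := fun _ => B) ω.b),
    (ω.k (Fin.last _), ω.l (Fin.last _)), (ω.a (Fin.last _), ω.b (Fin.last _)))
  left_inv x := by
    simp [k, l, a, b]
  right_inv ω := by
    simp [k, l, a, b]

end Play

section Values

variable {X Y : Type*}

/-- `v = max_x min_y g x y`, where all the minima and the maximum are attained. -/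
def IsMaxmin (g : X → Y → ℝ) (v : ℝ) : Prop :=
  (∀ x, ∃ m, IsLeast (Set.range fun y => g x y) m) ∧
    IsGreatest {m | ∃ x, IsLeast (Set.range fun y => g x y) m} v

/-- `v = min_y max_x g x y`, where all the maxima and the minimum are attained. -/
def IsMinmax (g : X → Y → ℝ) (v : ℝ) : Prop :=
  (∀ y, ∃ m, IsGreatest (Set.range fun x => g x y) m) ∧
    IsLeast {m | ∃ y, IsGreatest (Set.range fun x => g x y) m} v

/-- `v` is the value of the zero-sum game in which `x` is chosen to maximize and `y` is chosen to
minimize `g x y`: the maxmin and the minmax exist and both are equal to `v`. -/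
def IsGameValue (g : X → Y → ℝ) (v : ℝ) : Prop := IsMaxmin g v ∧ IsMinmax g v

/-- `x` is a security strategy of the maximizer: it ensures the maxmin value. -/
def IsSecurity1 (g : X → Y → ℝ) (x : X) : Prop :=
  ∃ v, IsMaxmin g v ∧ IsLeast (Set.range fun y => g x y) v

/-- `y` is a security strategy of the minimizer: it ensures the minmax value. -/
def IsSecurity2 (g : X → Y → ℝ) (y : Y) : Prop :=
  ∃ v, IsMinmax g v ∧ IsGreatest (Set.range fun x => g x y) v

end Values

namespace Game

variable {K L A B : Type*} [Fintype K] [Fintype L] [Fintype A] [Fintype B]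

/-- The probability of a play under initial distributions `p`, `q` and strategies `σ`, `τ`:
both initial states are drawn independently, at each stage the actions are drawn independently
given the players' information, and the states then move independently. -/
def prob (g : Game K L A B) (n : ℕ) (p : stdSimplex ℝ K) (q : stdSimplex ℝ L)
    (σ : Strategy K A B A) (τ : Strategy L A B B) (ω : Play K L A B n) : ℝ :=
  p (ω.k 0) * q (ω.l 0) *
    ∏ t : Fin n, (σ t (ω.info1 t) (ω.a t) * τ t (ω.info2 t) (ω.b t) *
      (g.P (ω.a t) (ω.b t) (ω.k t.castSucc) (ω.k t.succ) *
        g.Q (ω.a t) (ω.b t) (ω.l t.castSucc) (ω.l t.succ)))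

/-- The expectation `E_{p,q,σ,τ}` of a function of the play. -/
def expect (g : Game K L A B) (n : ℕ) (p : stdSimplex ℝ K) (q : stdSimplex ℝ L)
    (σ : Strategy K A B A) (τ : Strategy L A B B) (f : Play K L A B n → ℝ) : ℝ :=
  ∑ ω : Play K L A B n, g.prob n p q σ τ ω * f ω

/-- The total discounted payoff of a play. -/
def total (g : Game K L A B) (n : ℕ) (lam : ℝ) (ω : Play K L A B n) : ℝ :=
  ∑ t : Fin n, lam ^ (t : ℕ) * g.G (ω.k t.castSucc) (ω.l t.castSucc) (ω.a t) (ω.b t)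

/-- The payoff of the primal game. -/
def payoff (g : Game K L A B) (n : ℕ) (lam : ℝ) (p : stdSimplex ℝ K) (q : stdSimplex ℝ L)
    (σ : Strategy K A B A) (τ : Strategy L A B B) : ℝ :=
  g.expect n p q σ τ (g.total n lam)

/-- The payoff of the type 1 dual game with initial vector payoff `μ`: player 1's strategy is a
pair, consisting of the distribution of its own initial state and a behavior strategy. -/
def dualPayoff1 (g : Game K L A B) (n : ℕ) (lam : ℝ) (μ : K → ℝ) (q : stdSimplex ℝ L)
    (x : stdSimplex ℝ K × Strategy K A B A) (τ : Strategy L A B B) : ℝ :=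
  g.expect n x.1 q x.2 τ fun ω => μ (ω.k 0) + g.total n lam ω

/-- The payoff of the type 2 dual game with initial vector payoff `ν`: player 2's strategy is a
pair, consisting of the distribution of its own initial state and a behavior strategy. -/
def dualPayoff2 (g : Game K L A B) (n : ℕ) (lam : ℝ) (p : stdSimplex ℝ K) (ν : L → ℝ)
    (σ : Strategy K A B A) (y : stdSimplex ℝ L × Strategy L A B B) : ℝ :=
  g.expect n p y.1 σ y.2 fun ω => ν (ω.l 0) + g.total n lam ω

/-- `E_{p,q,σ,τ}(total payoff | k_1 = k)`: the expected payoff if player 1's initial state is `k`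
(see `payoffGiven1_eq` for the agreement with the elementary conditional expectation). -/
def payoffGiven1 [DecidableEq K] (g : Game K L A B) (n : ℕ) (lam : ℝ) (q : stdSimplex ℝ L)
    (k : K) (σ : Strategy K A B A) (τ : Strategy L A B B) : ℝ :=
  g.payoff n lam (stdSimplex.vertex k) q σ τ

/-- `E_{p,q,σ,τ}(total payoff | l_1 = l)`: the expected payoff if player 2's initial state is `l`
(see `payoffGiven2_eq` for the agreement with the elementary conditional expectation). -/
def payoffGiven2 [DecidableEq L] (g : Game K L A B) (n : ℕ) (lam : ℝ) (p : stdSimplex ℝ K)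
    (l : L) (σ : Strategy K A B A) (τ : Strategy L A B B) : ℝ :=
  g.payoff n lam p (stdSimplex.vertex l) σ τ

/-- `m = α_l(σ) = min_τ E_{p,q,σ,τ}(total payoff | l_1 = l)`. -/
def IsAlpha [DecidableEq L] (g : Game K L A B) (n : ℕ) (lam : ℝ) (p : stdSimplex ℝ K)
    (σ : Strategy K A B A) (l : L) (m : ℝ) : Prop :=
  IsLeast (Set.range fun τ : Strategy L A B B => g.payoffGiven2 n lam p l σ τ) m

/-- `m = β_k(τ) = max_σ E_{p,q,σ,τ}(total payoff | k_1 = k)`. -/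
def IsBeta [DecidableEq K] (g : Game K L A B) (n : ℕ) (lam : ℝ) (q : stdSimplex ℝ L)
    (τ : Strategy L A B B) (k : K) (m : ℝ) : Prop :=
  IsGreatest (Set.range fun σ : Strategy K A B A => g.payoffGiven1 n lam q k σ τ) m

/-! ## The linear programs

The variables at stages `t ≥ n` (for `R`, `S`) and `t > n` (for `U`, `Z`) occur neither in the
constraints nor in the objective functions. -/

/-- `P_{a_{t-1},b_{t-1}}(k_{t-1},k_t) R_{I_{t-1}}(a_{t-1})`, which at the first stage is `p(k_1)`. -/
def inflow1 (g : Game K L A B) (p : stdSimplex ℝ K) (R : ∀ t : ℕ, Info K A B t → A → ℝ) :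
    ∀ t : ℕ, Info K A B t → ℝ
  | 0, I => p I.cur
  | t + 1, I => g.P I.lastA I.lastB I.prev.cur I.cur * R t I.prev I.lastA

/-- `Q_{a_{t-1},b_{t-1}}(l_{t-1},l_t) S_{J_{t-1}}(b_{t-1})`, which at the first stage is `q(l_1)`. -/
def inflow2 (g : Game K L A B) (q : stdSimplex ℝ L) (S : ∀ t : ℕ, Info L A B t → B → ℝ) :
    ∀ t : ℕ, Info L A B t → ℝ
  | 0, J => q J.cur
  | t + 1, J => g.Q J.lastA J.lastB J.prev.cur J.cur * S t J.prev J.lastB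

/-- The constraints of player 1's linear program. -/
structure Feasible1 (g : Game K L A B) (n : ℕ) (lam : ℝ) (p : stdSimplex ℝ K)
    (R : ∀ t : ℕ, Info K A B t → A → ℝ) (U : ∀ t : ℕ, Info L A B t → ℝ) : Prop where
  payoff_le : ∀ t < n, ∀ (J : Info L A B t) (b : B),
    U t J ≤ ∑ k : Fin (t + 1) → K, ∑ a, R t ⟨k, J.a, J.b⟩ a *
        (lam ^ t * g.G (k (Fin.last t)) J.cur a b)
      + ∑ l' : L, ∑ a, g.Q a b J.cur l' * U (t + 1) (J.extend a b l')
  flow : ∀ t < n, ∀ I : Info K A B t, ∑ a, R t I a = g.inflow1 p R t I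
  terminal : ∀ J : Info L A B n, U n J = 0
  nonneg : ∀ t < n, ∀ (I : Info K A B t) (a : A), 0 ≤ R t I a

/-- The constraints of player 2's linear program. -/
structure Feasible2 (g : Game K L A B) (n : ℕ) (lam : ℝ) (q : stdSimplex ℝ L)
    (S : ∀ t : ℕ, Info L A B t → B → ℝ) (Z : ∀ t : ℕ, Info K A B t → ℝ) : Prop where
  le_payoff : ∀ t < n, ∀ (I : Info K A B t) (a : A),
    ∑ l : Fin (t + 1) → L, ∑ b, S t ⟨l, I.a, I.b⟩ b *
        (lam ^ t * g.G I.cur (l (Fin.last t)) a b)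
      + ∑ k' : K, ∑ b, g.P a b I.cur k' * Z (t + 1) (I.extend a b k') ≤ Z t I
  flow : ∀ t < n, ∀ J : Info L A B t, ∑ b, S t J b = g.inflow2 q S t J
  terminal : ∀ I : Info K A B n, Z n I = 0
  nonneg : ∀ t < n, ∀ (J : Info L A B t) (b : B), 0 ≤ S t J b

/-- The objective `∑_l q(l) U_{J_1}`, `J_1 = {l}`, of player 1's linear program. -/
def objective1 (q : stdSimplex ℝ L) (U : ∀ t : ℕ, Info L A B t → ℝ) : ℝ :=
  ∑ l : L, q l * U 0 (Info.start l)

/-- The objective `∑_k p(k) Z_{I_1}`, `I_1 = {k}`, of player 2's linear program. -/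
def objective2 (p : stdSimplex ℝ K) (Z : ∀ t : ℕ, Info K A B t → ℝ) : ℝ :=
  ∑ k : K, p k * Z 0 (Info.start k)

/-- `(R, U)` is an optimal solution of player 1's linear program. -/
def IsOptimal1 (g : Game K L A B) (n : ℕ) (lam : ℝ) (p : stdSimplex ℝ K) (q : stdSimplex ℝ L)
    (R : ∀ t : ℕ, Info K A B t → A → ℝ) (U : ∀ t : ℕ, Info L A B t → ℝ) : Prop :=
  g.Feasible1 n lam p R U ∧
    ∀ R' U', g.Feasible1 n lam p R' U' → objective1 q U' ≤ objective1 q U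

/-- `(S, Z)` is an optimal solution of player 2's linear program. -/
def IsOptimal2 (g : Game K L A B) (n : ℕ) (lam : ℝ) (p : stdSimplex ℝ K) (q : stdSimplex ℝ L)
    (S : ∀ t : ℕ, Info L A B t → B → ℝ) (Z : ∀ t : ℕ, Info K A B t → ℝ) : Prop :=
  g.Feasible2 n lam q S Z ∧
    ∀ S' Z', g.Feasible2 n lam q S' Z' → objective2 p Z ≤ objective2 p Z'

/-- `σ_t(I_t)(a_t) = R_{I_t}(a_t) / (P_{a_{t-1},b_{t-1}}(k_{t-1},k_t) R_{I_{t-1}}(a_{t-1}))` wherever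
the denominator is nonzero; elsewhere `σ_t(I_t)` may be any distribution. -/
def Induces1 (g : Game K L A B) (n : ℕ) (p : stdSimplex ℝ K)
    (R : ∀ t : ℕ, Info K A B t → A → ℝ) (σ : Strategy K A B A) : Prop :=
  ∀ t < n, ∀ I : Info K A B t, g.inflow1 p R t I ≠ 0 →
    ∀ a, σ t I a = R t I a / g.inflow1 p R t I

/-- `τ_t(J_t)(b_t) = S_{J_t}(b_t) / (Q_{a_{t-1},b_{t-1}}(l_{t-1},l_t) S_{J_{t-1}}(b_{t-1}))` wherever
the denominator is nonzero; elsewhere `τ_t(J_t)` may be any distribution. -/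
def Induces2 (g : Game K L A B) (n : ℕ) (q : stdSimplex ℝ L)
    (S : ∀ t : ℕ, Info L A B t → B → ℝ) (τ : Strategy L A B B) : Prop :=
  ∀ t < n, ∀ J : Info L A B t, g.inflow2 q S t J ≠ 0 →
    ∀ b, τ t J b = S t J b / g.inflow2 q S t J

/-- `ν` is an optimal solution of `v(p,q) = max_ν (w²(p,ν) - qᵀν)`, where `w²(p,ν)` is the value of
the type 2 dual game. -/
def IsSpecialNu (g : Game K L A B) (n : ℕ) (lam : ℝ) (p : stdSimplex ℝ K) (q : stdSimplex ℝ L)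
    (v : ℝ) (ν : L → ℝ) : Prop :=
  (∀ ν' : L → ℝ, ∃ w, IsGameValue (g.dualPayoff2 n lam p ν') w ∧ w - ∑ l, q l * ν' l ≤ v) ∧
    ∃ w, IsGameValue (g.dualPayoff2 n lam p ν) w ∧ w - ∑ l, q l * ν l = v

/-- `μ` is an optimal solution of `v(p,q) = min_μ (w¹(μ,q) - pᵀμ)`, where `w¹(μ,q)` is the value of
the type 1 dual game. -/
def IsSpecialMu (g : Game K L A B) (n : ℕ) (lam : ℝ) (p : stdSimplex ℝ K) (q : stdSimplex ℝ L)
    (v : ℝ) (μ : K → ℝ) : Prop :=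
  (∀ μ' : K → ℝ, ∃ w, IsGameValue (g.dualPayoff1 n lam μ' q) w ∧ v ≤ w - ∑ k, p k * μ' k) ∧
    ∃ w, IsGameValue (g.dualPayoff1 n lam μ q) w ∧ w - ∑ k, p k * μ k = v

/-! ## Agreement of `payoffGiven1`, `payoffGiven2` with conditional expectations -/

theorem prob_snoc (g : Game K L A B) (n : ℕ) (p : stdSimplex ℝ K) (q : stdSimplex ℝ L)
    (σ : Strategy K A B A) (τ : Strategy L A B B) (ω : Play K L A B n) (k : K) (l : L)
    (a : A) (b : B) :
    g.prob (n + 1) p q σ τ (Play.snocEquiv K L A B n (ω, ((k, l), (a, b)))) =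
      g.prob n p q σ τ ω * (σ n ⟨ω.k, ω.a, ω.b⟩ a * τ n ⟨ω.l, ω.a, ω.b⟩ b *
        (g.P a b (ω.k (Fin.last n)) k * g.Q a b (ω.l (Fin.last n)) l)) := by
  have h0 : (Fin.snoc (α := fun _ => K) ω.1 k 0 : K) = ω.1 0 :=
    Fin.snoc_castSucc (α := fun _ => K) k ω.1 0
  have h1 : (Fin.snoc (α := fun _ => L) ω.2.1 l 0 : L) = ω.2.1 0 :=
    Fin.snoc_castSucc (α := fun _ => L) l ω.2.1 0
  have i1 : ∀ t : Fin n, (Play.snocEquiv K L A B n (ω, ((k, l), (a, b)))).info1 t.castSucc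
      = ω.info1 t := by
    intro t
    simp only [Play.info1, Info.upTo, Play.snocEquiv, Play.k, Play.a, Play.b, Equiv.coe_fn_mk]
    congr 1 <;> funext i
    · exact Fin.snoc_castSucc (α := fun _ => K) _ _ (Fin.castLE (by omega) i)
    · exact Fin.snoc_castSucc (α := fun _ => A) _ _ (Fin.castLE t.is_lt.le i)
    · exact Fin.snoc_castSucc (α := fun _ => B) _ _ (Fin.castLE t.is_lt.le i)
  have i2 : ∀ t : Fin n, (Play.snocEquiv K L A B n (ω, ((k, l), (a, b)))).info2 t.castSucc
      = ω.info2 t := by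
    intro t
    simp only [Play.info2, Info.upTo, Play.snocEquiv, Play.l, Play.a, Play.b, Equiv.coe_fn_mk]
    congr 1 <;> funext i
    · exact Fin.snoc_castSucc (α := fun _ => L) _ _ (Fin.castLE (by omega) i)
    · exact Fin.snoc_castSucc (α := fun _ => A) _ _ (Fin.castLE t.is_lt.le i)
    · exact Fin.snoc_castSucc (α := fun _ => B) _ _ (Fin.castLE t.is_lt.le i)
  have j1 : (Play.snocEquiv K L A B n (ω, ((k, l), (a, b)))).info1 (Fin.last n)
      = ⟨ω.k, ω.a, ω.b⟩ := by
    simp only [Play.info1, Info.upTo, Play.snocEquiv, Play.k, Play.a, Play.b, Equiv.coe_fn_mk]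
    congr 1 <;> funext i
    · exact Fin.snoc_castSucc (α := fun _ => K) _ _ i
    · exact Fin.snoc_castSucc (α := fun _ => A) _ _ i
    · exact Fin.snoc_castSucc (α := fun _ => B) _ _ i
  have j2 : (Play.snocEquiv K L A B n (ω, ((k, l), (a, b)))).info2 (Fin.last n)
      = ⟨ω.l, ω.a, ω.b⟩ := by
    simp only [Play.info2, Info.upTo, Play.snocEquiv, Play.l, Play.a, Play.b, Equiv.coe_fn_mk]
    congr 1 <;> funext i
    · exact Fin.snoc_castSucc (α := fun _ => L) _ _ i
    · exact Fin.snoc_castSucc (α := fun _ => A) _ _ i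
    · exact Fin.snoc_castSucc (α := fun _ => B) _ _ i
  unfold prob
  rw [Fin.prod_univ_castSucc]
  simp only [i1, i2, j1, j2]
  simp only [Play.snocEquiv, Play.k, Play.l, Play.a, Play.b, Equiv.coe_fn_mk, Fin.snoc_castSucc,
    Fin.snoc_last, ← Fin.castSucc_succ, Fin.succ_last, Fin.val_castSucc,
    Fin.val_last, h0, h1]
  ring

/-- The probabilities of all plays sum to one. -/
theorem sum_prob (g : Game K L A B) (n : ℕ) (p : stdSimplex ℝ K) (q : stdSimplex ℝ L)
    (σ : Strategy K A B A) (τ : Strategy L A B B) :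
    ∑ ω : Play K L A B n, g.prob n p q σ τ ω = 1 := by
  induction n with
  | zero =>
    have hp : ∑ k, p k = 1 := p.2.2
    have hq : ∑ l, q l = 1 := q.2.2
    have e : ∑ ω : Play K L A B 0, g.prob 0 p q σ τ ω = ∑ x : K × L, p x.1 * q x.2 := by
      refine Fintype.sum_equiv
        ⟨fun ω => (Play.k ω 0, Play.l ω 0), fun x => (fun _ => x.1, fun _ => x.2, Fin.elim0, Fin.elim0),
          fun ω => ?_, fun x => rfl⟩ _ _ fun ω => ?_
      · obtain ⟨k, l, a, b⟩ := ω
        refine Prod.ext ?_ (Prod.ext ?_ (Prod.ext ?_ ?_)) <;> funext i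
        · exact congrArg k (Subsingleton.elim (α := Fin 1) _ _)
        · exact congrArg l (Subsingleton.elim (α := Fin 1) _ _)
        · exact i.elim0
        · exact i.elim0
      · simp [prob]
        rfl
    rw [e, Fintype.sum_prod_type]
    simp [← Finset.mul_sum, hq, hp]
  | succ n ih =>
    rw [← (Play.snocEquiv K L A B n).sum_comp, Fintype.sum_prod_type, ← ih]
    refine Finset.sum_congr rfl fun ω _ => ?_
    have hP : ∀ a b k, ∑ k', g.P a b k k' = 1 := fun a b k => (g.P_mem a b k).2
    have hQ : ∀ a b l, ∑ l', g.Q a b l l' = 1 := fun a b l => (g.Q_mem a b l).2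
    have hs : ∀ I, ∑ a, σ n I a = 1 := fun I => (σ n I).2.2
    have ht : ∀ J, ∑ b, τ n J b = 1 := fun J => (τ n J).2.2
    rw [Fintype.sum_prod_type, Finset.sum_comm]
    simp only [Fintype.sum_prod_type, prob_snoc, ← Finset.mul_sum, hP, hQ, hs, ht, mul_one]

theorem sum_filter_l [DecidableEq L] (g : Game K L A B) (n : ℕ) (p : stdSimplex ℝ K)
    (q : stdSimplex ℝ L) (σ : Strategy K A B A) (τ : Strategy L A B B) (l : L)
    (f : Play K L A B n → ℝ) :
    ∑ ω : Play K L A B n with ω.l 0 = l, g.prob n p q σ τ ω * f ω =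
      q l * g.expect n p (stdSimplex.vertex l) σ τ f := by
  rw [expect, Finset.mul_sum, Finset.sum_filter]
  refine Finset.sum_congr rfl fun ω _ => ?_
  have hv : (stdSimplex.vertex (S := ℝ) l) (ω.l 0) = if ω.l 0 = l then 1 else 0 := by
    change Pi.single (M := fun _ => ℝ) l (1 : ℝ) (ω.l 0) = _
    rw [Pi.single_apply]
  by_cases h : ω.l 0 = l
  · rw [if_pos h, prob, prob, hv, if_pos h, h]; ring
  · rw [if_neg h, prob, hv, if_neg h]; ring

theorem sum_filter_k [DecidableEq K] (g : Game K L A B) (n : ℕ) (p : stdSimplex ℝ K)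
    (q : stdSimplex ℝ L) (σ : Strategy K A B A) (τ : Strategy L A B B) (k : K)
    (f : Play K L A B n → ℝ) :
    ∑ ω : Play K L A B n with ω.k 0 = k, g.prob n p q σ τ ω * f ω =
      p k * g.expect n (stdSimplex.vertex k) q σ τ f := by
  rw [expect, Finset.mul_sum, Finset.sum_filter]
  refine Finset.sum_congr rfl fun ω _ => ?_
  have hv : (stdSimplex.vertex (S := ℝ) k) (ω.k 0) = if ω.k 0 = k then 1 else 0 := by
    change Pi.single (M := fun _ => ℝ) k (1 : ℝ) (ω.k 0) = _
    rw [Pi.single_apply]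
  by_cases h : ω.k 0 = k
  · rw [if_pos h, prob, prob, hv, if_pos h, h]; ring
  · rw [if_neg h, prob, hv, if_neg h]; ring

/-- If `q(l) > 0`, then `payoffGiven2` is the elementary conditional expectation of the total
payoff given that player 2's initial state is `l`. -/
theorem payoffGiven2_eq [DecidableEq L] (g : Game K L A B) (n : ℕ) (lam : ℝ)
    (p : stdSimplex ℝ K) (q : stdSimplex ℝ L) (σ : Strategy K A B A) (τ : Strategy L A B B)
    (l : L) (hl : 0 < q l) :
    g.payoffGiven2 n lam p l σ τ =
      (∑ ω : Play K L A B n with ω.l 0 = l, g.prob n p q σ τ ω * g.total n lam ω) /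
        ∑ ω : Play K L A B n with ω.l 0 = l, g.prob n p q σ τ ω := by
  have h1 := g.sum_filter_l n p q σ τ l fun _ => 1
  simp only [expect, mul_one, sum_prob] at h1
  rw [sum_filter_l, h1, payoffGiven2, payoff]
  field_simp

/-- If `p(k) > 0`, then `payoffGiven1` is the elementary conditional expectation of the total
payoff given that player 1's initial state is `k`. -/
theorem payoffGiven1_eq [DecidableEq K] (g : Game K L A B) (n : ℕ) (lam : ℝ)
    (p : stdSimplex ℝ K) (q : stdSimplex ℝ L) (σ : Strategy K A B A) (τ : Strategy L A B B)
    (k : K) (hk : 0 < p k) :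
    g.payoffGiven1 n lam q k σ τ =
      (∑ ω : Play K L A B n with ω.k 0 = k, g.prob n p q σ τ ω * g.total n lam ω) /
        ∑ ω : Play K L A B n with ω.k 0 = k, g.prob n p q σ τ ω := by
  have h1 := g.sum_filter_k n p q σ τ k fun _ => 1
  simp only [expect, mul_one, sum_prob] at h1
  rw [sum_filter_k, h1, payoffGiven1, payoff]
  field_simp

end Game

end BayesGame

end

/-! A strategy of a player is replaced by its realization plan: at each information and own action,
the product of the player's own initial and transition probabilities and of its own action
probabilities. Since the two state processes move independently given the public actions, the
probability of a play splits into one such factor per player (`prob_eq`), so the payoff is bilinear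
in the two plans (`payoff_eq`). Plans are described by linear flow constraints, and conversely every
plan comes from any strategy obtained by normalising it; where the inflow vanishes the plan vanishes
too, so the arbitrary choice there does not matter (`IsPlan.eq_plan`).

Plans, together with their initial distributions, form a compact convex set on which the payoff is
affine and continuous in each argument. Sion's theorem then gives values for the primal game and
both dual games at once.

No duality theorem of linear programming is used. Fix a plan `R` of player 1. Player 2 then faces a
one-person dynamic program, and the first constraint says that `U` is a subsolution of its Bellman
equation. The weights of `R` are absorbed into `U`, which keeps the constraints linear. Summing the
slacks against a plan of player 2 telescopes (`IsPlan.planReward_eq`): a subsolution bounds the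
payoff from below, and the Bellman solution attains the bound. So the maximum of the program is the
maxmin. The constraints do not involve `q`, so the bound and its attaining reply serve all initial
distributions of player 2 simultaneously. Point masses give the statements on `α_l`, and the choice
`ν = -U` makes the initial term cancel `U`, which gives the dual game statement. Player 2's program
is treated by reversing the inequalities. -/

noncomputable section

namespace BayesGame

/-! ### Values from a minimax theorem on compact convex representations -/

section Minimax

variable {X Y : Type*}

/-- A saddle point, together with the attainment of all best replies, gives the value. -/
theorem isGameValue_of_saddle {g : X → Y → ℝ} (h1 : ∀ x, ∃ m, IsLeast (Set.range fun y => g x y) m)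
    (h2 : ∀ y, ∃ m, IsGreatest (Set.range fun x => g x y) m) {x₀ : X} {y₀ : Y}
    (h : ∀ x y, g x y₀ ≤ g x₀ y) : IsGameValue g (g x₀ y₀) := by
  refine ⟨⟨h1, ⟨x₀, ⟨y₀, rfl⟩, ?_⟩, ?_⟩, ⟨h2, ⟨y₀, ⟨x₀, rfl⟩, ?_⟩, ?_⟩⟩
  · rintro _ ⟨y, rfl⟩
    exact h x₀ y
  · rintro m ⟨x, hm⟩
    exact (hm.2 ⟨y₀, rfl⟩).trans (h x y₀)
  · rintro _ ⟨x, rfl⟩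
    exact h x y₀
  · rintro m ⟨y, hm⟩
    exact (h x₀ y).trans (hm.2 ⟨x₀, rfl⟩)

/-- A game that is represented by a continuous function on compact convex sets, quasiconcave in
the first and quasiconvex in the second variable, has a value. -/
theorem exists_isGameValue_of_represented {E F : Type*}
    [TopologicalSpace E] [AddCommGroup E] [Module ℝ E] [IsTopologicalAddGroup E]
    [ContinuousSMul ℝ E] [TopologicalSpace F] [AddCommGroup F] [Module ℝ F]
    [IsTopologicalAddGroup F] [ContinuousSMul ℝ F] {C : Set E} {D : Set F} {f : E → F → ℝ}
    {g : X → Y → ℝ} {φ : X → E} {ψ : Y → F} [Nonempty X] [Nonempty Y]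
    (hC : IsCompact C) (hD : IsCompact D) (cC : Convex ℝ C) (cD : Convex ℝ D)
    (f1 : ∀ d, Continuous fun c => f c d) (f2 : ∀ c, Continuous (f c))
    (f3 : ∀ d, QuasiconcaveOn ℝ C fun c => f c d) (f4 : ∀ c, QuasiconvexOn ℝ D (f c))
    (hφ : ∀ x, φ x ∈ C) (hψ : ∀ y, ψ y ∈ D) (hg : ∀ x y, g x y = f (φ x) (ψ y))
    (sφ : ∀ c ∈ C, ∃ x, ∀ d, f c d = f (φ x) d) (sψ : ∀ d ∈ D, ∃ y, ∀ c, f c d = f c (ψ y)) :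
    ∃ v, IsGameValue g v := by
  have neC : C.Nonempty := ⟨_, hφ (Classical.arbitrary X)⟩
  have neD : D.Nonempty := ⟨_, hψ (Classical.arbitrary Y)⟩
  -- The minimizing variable comes first in Sion's theorem, hence the swapped arguments of `f`.
  obtain ⟨d, hd, c, hc, hdc⟩ := Sion.exists_isSaddlePointOn (X := D) (Y := C)
    (f := fun d c => f c d) neD cD hD (fun c _ => (f2 c).lowerSemicontinuous.lowerSemicontinuousOn _)
    (fun c _ => f4 c) cC neC hC (fun d _ => (f1 d).upperSemicontinuous.upperSemicontinuousOn _)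
    (fun d _ => f3 d)
  obtain ⟨x₀, hx₀⟩ := sφ c hc
  obtain ⟨y₀, hy₀⟩ := sψ d hd
  refine ⟨_, isGameValue_of_saddle (x₀ := x₀) (y₀ := y₀) (fun x => ?_) (fun y => ?_) fun x y => ?_⟩
  -- A saddle point does not give best replies to the other strategies. These come from compactness,
  -- and the minimizer is pulled back to `Y` by `sψ`.
  · obtain ⟨d, hd, hmin⟩ := hD.exists_isMinOn neD (f2 (φ x)).continuousOn
    obtain ⟨y, hy⟩ := sψ d hd
    refine ⟨_, ⟨y, rfl⟩, ?_⟩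
    rintro _ ⟨y', rfl⟩
    simp only [hg, ← hy]
    exact hmin (hψ y')
  · obtain ⟨c, hc, hmax⟩ := hC.exists_isMaxOn neC (f1 (ψ y)).continuousOn
    obtain ⟨x, hx⟩ := sφ c hc
    refine ⟨_, ⟨x, rfl⟩, ?_⟩
    rintro _ ⟨x', rfl⟩
    simp only [hg, ← hx]
    exact hmax (hφ x')
  · rw [hg, hg, ← hx₀, ← hy₀]
    exact hdc (ψ y) (hψ y) (φ x) (hφ x)

end Minimax

/-! ### Decomposition of the information stage by stage -/

namespace Info

variable {S A B : Type*}

@[simp] theorem prev_extend {t : ℕ} (I : Info S A B t) (a : A) (b : B) (s : S) :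
    (I.extend a b s).prev = I := by
  cases I
  simp [extend, prev]

@[simp] theorem cur_extend {t : ℕ} (I : Info S A B t) (a : A) (b : B) (s : S) :
    (I.extend a b s).cur = s := by
  simp [extend, cur]

@[simp] theorem lastA_extend {t : ℕ} (I : Info S A B t) (a : A) (b : B) (s : S) :
    (I.extend a b s).lastA = a := by
  simp [extend, lastA]

@[simp] theorem lastB_extend {t : ℕ} (I : Info S A B t) (a : A) (b : B) (s : S) :
    (I.extend a b s).lastB = b := by
  simp [extend, lastB]

theorem start_cur (I : Info S A B 0) : start I.cur = I := by
  cases I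
  simp only [start, cur, mk.injEq]
  refine ⟨funext fun i => ?_, funext fun i => i.elim0, funext fun i => i.elim0⟩
  rw [Subsingleton.elim (α := Fin 1) i (Fin.last 0)]

theorem extend_prev {t : ℕ} (I : Info S A B (t + 1)) :
    I.prev.extend I.lastA I.lastB I.cur = I := by
  cases I
  simp only [extend, prev, lastA, lastB, cur, mk.injEq]
  exact ⟨Fin.snoc_init_self (α := fun _ => S) _, Fin.snoc_init_self (α := fun _ => A) _,
    Fin.snoc_init_self (α := fun _ => B) _⟩

/-- Information as a triple. -/
def equivProd (S A B : Type*) (t : ℕ) :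
    Info S A B t ≃ (Fin (t + 1) → S) × (Fin t → A) × (Fin t → B) where
  toFun I := (I.st, I.a, I.b)
  invFun x := ⟨x.1, x.2.1, x.2.2⟩

instance [Fintype S] [Fintype A] [Fintype B] (t : ℕ) : Fintype (Info S A B t) :=
  Fintype.ofEquiv _ (equivProd S A B t).symm

/-- The initial information is the initial state. -/
def equivZero (S A B : Type*) : S ≃ Info S A B 0 where
  toFun := start
  invFun := cur
  right_inv := start_cur

/-- The information one stage later consists of the information, both actions and a new state. -/
def equivSucc (S A B : Type*) (t : ℕ) : Info S A B t × A × B × S ≃ Info S A B (t + 1) where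
  toFun x := x.1.extend x.2.1 x.2.2.1 x.2.2.2
  invFun I := (I.prev, I.lastA, I.lastB, I.cur)
  left_inv x := by simp
  right_inv := extend_prev

end Info

/-! ## Realization plans

`M` is the transition kernel of a player's own state, and `own a b` its own action. -/

section Plan

variable {S A B C : Type*}

/-- The total weight that must be distributed over the own actions at an information. -/
def planInflow (M : A → B → S → S → ℝ) (own : A → B → C) (p : S → ℝ)
    (R : ∀ t : ℕ, Info S A B t → C → ℝ) : ∀ t : ℕ, Info S A B t → ℝ
  | 0, I => p I.cur
  | t + 1, I => M I.lastA I.lastB I.prev.cur I.cur * R t I.prev (own I.lastA I.lastB)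

theorem planInflow_extend (M : A → B → S → S → ℝ) (own : A → B → C) (p : S → ℝ)
    (R : ∀ t : ℕ, Info S A B t → C → ℝ) {t : ℕ} (I : Info S A B t) (a : A) (b : B) (s : S) :
    planInflow M own p R (t + 1) (I.extend a b s) = M a b I.cur s * R t I (own a b) := by
  simp [planInflow]

variable [Fintype C]

/-- The weight of an information under a strategy: the product of the probabilities of the own
states and the own actions. -/
def planWeight (M : A → B → S → S → ℝ) (own : A → B → C) (p : S → ℝ) (σ : Strategy S A B C) :
    ∀ t : ℕ, Info S A B t → ℝ
  | 0, I => p I.cur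
  | t + 1, I => M I.lastA I.lastB I.prev.cur I.cur *
      (planWeight M own p σ t I.prev * σ t I.prev (own I.lastA I.lastB))

/-- The realization plan of a strategy. -/
def plan (M : A → B → S → S → ℝ) (own : A → B → C) (p : S → ℝ) (σ : Strategy S A B C) (t : ℕ)
    (I : Info S A B t) (c : C) : ℝ :=
  planWeight M own p σ t I * σ t I c

theorem planInflow_plan (M : A → B → S → S → ℝ) (own : A → B → C) (p : S → ℝ)
    (σ : Strategy S A B C) (t : ℕ) (I : Info S A B t) :
    planInflow M own p (plan M own p σ) t I = planWeight M own p σ t I := by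
  cases t <;> rfl

/-- `R` is a realization plan at the stages `t < n`. -/
structure IsPlan (M : A → B → S → S → ℝ) (own : A → B → C) (p : S → ℝ) (n : ℕ)
    (R : ∀ t : ℕ, Info S A B t → C → ℝ) : Prop where
  flow : ∀ t < n, ∀ I, ∑ c, R t I c = planInflow M own p R t I
  nonneg : ∀ t < n, ∀ I c, 0 ≤ R t I c

/-- `σ` is the quotient of `R` and its inflow, wherever the latter is non-zero. -/
def PlanInduces (M : A → B → S → S → ℝ) (own : A → B → C) (p : S → ℝ) (n : ℕ)
    (R : ∀ t : ℕ, Info S A B t → C → ℝ) (σ : Strategy S A B C) : Prop :=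
  ∀ t < n, ∀ I : Info S A B t, planInflow M own p R t I ≠ 0 →
    ∀ c, σ t I c = R t I c / planInflow M own p R t I

variable {M : A → B → S → S → ℝ} {own : A → B → C} {p : S → ℝ} {n : ℕ}
  {R : ∀ t : ℕ, Info S A B t → C → ℝ}

theorem planWeight_nonneg (hM : ∀ a b s s', 0 ≤ M a b s s') (hp : ∀ s, 0 ≤ p s)
    (σ : Strategy S A B C) : ∀ (t : ℕ) (I : Info S A B t), 0 ≤ planWeight M own p σ t I
  | 0, _ => hp _
  | t + 1, I => mul_nonneg (hM _ _ _ _)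
      (mul_nonneg (planWeight_nonneg hM hp σ t I.prev) ((σ t I.prev).2.1 _))

theorem isPlan_plan (hM : ∀ a b s s', 0 ≤ M a b s s') (hp : ∀ s, 0 ≤ p s)
    (σ : Strategy S A B C) : IsPlan M own p n (plan M own p σ) where
  flow t _ I := by
    have h : ∑ c, σ t I c = 1 := (σ t I).2.2
    rw [planInflow_plan]
    simp only [plan, ← Finset.mul_sum, h, mul_one]
  nonneg t _ I c := mul_nonneg (planWeight_nonneg hM hp σ t I) ((σ t I).2.1 c)

/-- The flow equation makes the normalised plan sum to one wherever the inflow is non-zero;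
elsewhere any distribution will do. -/
theorem IsPlan.exists_induces [Nonempty C] (h : IsPlan M own p n R) :
    ∃ σ, PlanInduces M own p n R σ := by
  classical
  have key : ∀ (t : ℕ) (I : Info S A B t), ∃ x : stdSimplex ℝ C,
      t < n → planInflow M own p R t I ≠ 0 → ∀ c, x c = R t I c / planInflow M own p R t I := by
    intro t I
    by_cases ht : t < n ∧ planInflow M own p R t I ≠ 0
    · have h0 : 0 ≤ planInflow M own p R t I := by
        rw [← h.flow t ht.1 I]
        exact Finset.sum_nonneg fun c _ => h.nonneg t ht.1 I c
      refine ⟨⟨fun c => R t I c / planInflow M own p R t I,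
        fun c => div_nonneg (h.nonneg t ht.1 I c) h0, ?_⟩, fun _ _ c => rfl⟩
      rw [← Finset.sum_div, h.flow t ht.1 I, div_self ht.2]
    · exact ⟨Classical.arbitrary _, fun h1 h2 => absurd ⟨h1, h2⟩ ht⟩
  choose σ hσ using key
  exact ⟨σ, fun t ht I => hσ t I ht⟩

/-- By induction on the stage the inflow of `R` equals the weight of the information under `σ`.
Where it is zero, non-negativity and the flow equation force `R` to vanish, so the unspecified
values of `σ` are multiplied by zero. -/
theorem IsPlan.eq_plan (h : IsPlan M own p n R) {σ : Strategy S A B C}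
    (hσ : PlanInduces M own p n R σ) :
    ∀ t < n, ∀ I c, R t I c = plan M own p σ t I c := by
  intro t
  induction t with
  | zero =>
    intro ht I c
    by_cases h0 : planInflow M own p R 0 I = 0
    · have h1 := h.flow 0 ht I
      rw [h0, Finset.sum_eq_zero_iff_of_nonneg fun c _ => h.nonneg 0 ht I c] at h1
      rw [h1 c (Finset.mem_univ c), plan, planWeight, show p I.cur = 0 from h0, zero_mul]
    · rw [plan, hσ 0 ht I h0 c]
      exact (mul_div_cancel₀ _ h0).symm
  | succ t ih =>
    intro ht I c
    have e : planInflow M own p R (t + 1) I = planWeight M own p σ (t + 1) I := by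
      rw [← planInflow_plan]
      exact congrArg _ (ih (Nat.lt_of_succ_lt ht) _ _)
    by_cases h0 : planInflow M own p R (t + 1) I = 0
    · have h1 := h.flow (t + 1) ht I
      rw [h0, Finset.sum_eq_zero_iff_of_nonneg fun c _ => h.nonneg (t + 1) ht I c] at h1
      rw [h1 c (Finset.mem_univ c), plan, ← e, h0, zero_mul]
    · rw [plan, hσ _ ht I h0 c, ← e, mul_div_cancel₀ _ h0]

/-- Weights only decrease along a play. This provides the box needed for compactness. -/
theorem IsPlan.le_one (hM1 : ∀ a b s s', M a b s s' ≤ 1)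
    (hp1 : ∀ s, p s ≤ 1) (h : ∀ n, IsPlan M own p n R) :
    ∀ (t : ℕ) I c, R t I c ≤ 1 := by
  have h0 : ∀ (t : ℕ) I c, R t I c ≤ planInflow M own p R t I := fun t I c => by
    rw [← (h (t + 1)).flow t t.lt_succ_self I]
    exact Finset.single_le_sum (f := fun c => R t I c)
      (fun c _ => (h (t + 1)).nonneg t t.lt_succ_self I c) (Finset.mem_univ c)
  intro t
  induction t with
  | zero => exact fun I c => (h0 0 I c).trans (hp1 _)
  | succ t ih =>
    intro I c
    exact (h0 _ I c).trans (mul_le_one₀ (hM1 _ _ _ _)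
      ((h (t + 1)).nonneg t t.lt_succ_self _ _) (ih _ _))

/-- The realization plans (at all stages) whose initial distribution lies in `P`. -/
def planSet (M : A → B → S → S → ℝ) (own : A → B → C) (P : Set (S → ℝ)) :
    Set ((S → ℝ) × (∀ t : ℕ, Info S A B t → C → ℝ)) :=
  {x | x.1 ∈ P ∧ ∀ n, IsPlan M own x.1 n x.2}

theorem isPlan_forall_iff : (∀ n, IsPlan M own p n R) ↔
    ∀ t I, ∑ c, R t I c = planInflow M own p R t I ∧ ∀ c, 0 ≤ R t I c :=
  ⟨fun h t I => ⟨(h (t + 1)).flow t t.lt_succ_self I, (h (t + 1)).nonneg t t.lt_succ_self I⟩,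
    fun h _ => ⟨fun t _ I => (h t I).1, fun t _ I => (h t I).2⟩⟩

/-- Closed conditions inside a product of unit intervals, compact although there are infinitely many
stages. The plan conditions are imposed beyond the horizon as well, since coordinates left free
there would be unbounded. -/
theorem isCompact_planSet [Fintype S]
    (hM1 : ∀ a b s s', M a b s s' ≤ 1) {P : Set (S → ℝ)} (hP : IsClosed P)
    (hP1 : P ⊆ stdSimplex ℝ S) : IsCompact (planSet M own P) := by
  refine IsCompact.of_isClosed_subset
    (isCompact_Icc (a := (0 : (S → ℝ) × (∀ t : ℕ, Info S A B t → C → ℝ)))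
      (b := (fun _ => 1, fun _ _ _ => 1))) ?_ ?_
  · have e : planSet M own P = {x | x.1 ∈ P} ∩ ⋂ (t) (I : Info S A B t),
        ({x | ∑ c, x.2 t I c = planInflow M own x.1 x.2 t I} ∩ ⋂ c, {x | 0 ≤ x.2 t I c}) := by
      ext x
      simp [planSet, isPlan_forall_iff]
    rw [e]
    refine (hP.preimage continuous_fst).inter (isClosed_iInter fun t => isClosed_iInter fun I =>
      (isClosed_eq ?_ ?_).inter (isClosed_iInter fun c => isClosed_le ?_ ?_))
    · fun_prop
    · cases t <;> simp only [planInflow] <;> fun_prop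
    · fun_prop
    · fun_prop
  · rintro ⟨p, R⟩ ⟨hp, hR⟩
    have h1 : ∀ s, p s ≤ 1 := fun s => (mem_Icc_of_mem_stdSimplex (hP1 hp) s).2
    exact ⟨⟨fun s => (hP1 hp).1 s, fun t I c => (hR (t + 1)).nonneg t t.lt_succ_self I c⟩,
      h1, fun t I c => IsPlan.le_one hM1 h1 hR t I c⟩

/-- The inflow is jointly linear in the initial distribution and the plan. Keeping the distribution
as a coordinate covers the dual games, where it is chosen by a player. -/
theorem convex_planSet {P : Set (S → ℝ)} (hP : Convex ℝ P) : Convex ℝ (planSet M own P) := by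
  rintro ⟨p, R⟩ ⟨hp, hR⟩ ⟨p', R'⟩ ⟨hp', hR'⟩ x y hx hy hxy
  refine ⟨hP hp hp' hx hy hxy, ?_⟩
  simp only [isPlan_forall_iff] at hR hR' ⊢
  intro t I
  have e : planInflow M own (x • p + y • p') (x • R + y • R') t I =
      x * planInflow M own p R t I + y * planInflow M own p' R' t I := by
    cases t
    · simp [planInflow]
    · simp only [planInflow, Pi.add_apply, Pi.smul_apply, smul_eq_mul]; ring
  refine ⟨?_, fun c => ?_⟩
  · refine Eq.trans ?_ e.symm
    simp [Finset.sum_add_distrib, ← Finset.mul_sum, (hR t I).1, (hR' t I).1]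
  · exact add_nonneg (mul_nonneg hx ((hR t I).2 c)) (mul_nonneg hy ((hR' t I).2 c))

end Plan

/-! ### Dynamic programming for one player against fixed weights of the other -/

section BestReply

variable {S A B C O : Type*} [Fintype S] [Fintype O]

/-- The expectation of `U` one stage later, when the own action is `c`; the weights of the
opponent's actions `o` are part of `U`. The actions are related by `e : C × O ≃ A × B`. -/
def nextVal (M : A → B → S → S → ℝ) (e : C × O ≃ A × B) (U : ∀ t : ℕ, Info S A B t → ℝ) (t : ℕ)
    (J : Info S A B t) (c : C) : ℝ :=
  ∑ s : S, ∑ o : O, M (e (c, o)).1 (e (c, o)).2 J.cur s *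
    U (t + 1) (J.extend (e (c, o)).1 (e (c, o)).2 s)

/-- The least total reward that can be obtained in `m` stages from the stage `t` onwards. -/
def leastVal (M : A → B → S → S → ℝ) (e : C × O ≃ A × B) (r : ∀ t : ℕ, Info S A B t → C → ℝ) :
    ∀ (_ t : ℕ), Info S A B t → ℝ
  | 0, _, _ => 0
  | m + 1, t, J => ⨅ c, (r t J c + nextVal M e (fun t J => leastVal M e r m t J) t J c)

variable [Fintype A] [Fintype B]

variable {M : A → B → S → S → ℝ} {own : A → B → C} {e : C × O ≃ A × B} {p : S → ℝ} {n : ℕ}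
  {R r : ∀ t : ℕ, Info S A B t → C → ℝ} {U : ∀ t : ℕ, Info S A B t → ℝ}

theorem sum_planInflow_zero :
    ∑ J, planInflow M own p R 0 J * U 0 J = ∑ s, p s * U 0 (Info.start s) := by
  rw [← (Info.equivZero S A B).sum_comp]
  rfl

variable [Fintype C]

/-- The total reward `r` of a realization plan. -/
def planReward (n : ℕ) (r : ∀ t : ℕ, Info S A B t → C → ℝ)
    (R : ∀ t : ℕ, Info S A B t → C → ℝ) : ℝ :=
  ∑ t ∈ Finset.range n, ∑ J, ∑ c, R t J c * r t J c

/-- An information at the next stage is an information, two actions and a new state, and its inflow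
is a transition probability times the plan. Regrouping the actions into own and opposing ones by `e`
lets one argument serve both players. -/
theorem sum_planInflow_succ (he : ∀ c o, own (e (c, o)).1 (e (c, o)).2 = c) (t : ℕ) :
    ∑ J, planInflow M own p R (t + 1) J * U (t + 1) J =
      ∑ J, ∑ c, R t J c * nextVal M e U t J c := by
  rw [← (Info.equivSucc S A B t).sum_comp, Fintype.sum_prod_type]
  refine Finset.sum_congr rfl fun J _ => ?_
  have h1 : ∑ x : A × B × S, planInflow M own p R (t + 1) (Info.equivSucc S A B t (J, x)) *
        U (t + 1) (Info.equivSucc S A B t (J, x)) =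
      ∑ y : A × B, ∑ s, M y.1 y.2 J.cur s * R t J (own y.1 y.2) *
        U (t + 1) (J.extend y.1 y.2 s) := by
    rw [← (Equiv.prodAssoc A B S).sum_comp, Fintype.sum_prod_type]
    refine Finset.sum_congr rfl fun y _ => Finset.sum_congr rfl fun s _ => ?_
    rw [← planInflow_extend M own p R J y.1 y.2 s]
    rfl
  rw [h1, ← e.sum_comp, Fintype.sum_prod_type]
  refine Finset.sum_congr rfl fun c _ => ?_
  rw [nextVal, Finset.sum_comm, Finset.mul_sum]
  refine Finset.sum_congr rfl fun s _ => ?_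
  rw [Finset.mul_sum]
  refine Finset.sum_congr rfl fun o _ => ?_
  rw [he]
  ring

/-- The total reward of a plan is the initial expectation of `U` plus the weighted slacks. -/
theorem IsPlan.planReward_eq (h : IsPlan M own p n R)
    (he : ∀ c o, own (e (c, o)).1 (e (c, o)).2 = c) (hU : ∀ J, U n J = 0) :
    planReward n r R = ∑ s, p s * U 0 (Info.start s) +
      ∑ t ∈ Finset.range n, ∑ J, ∑ c, R t J c * (r t J c + nextVal M e U t J c - U t J) := by
  -- By the flow equation each stage's weighted slack is its reward plus a difference of consecutive
  -- inflow-weighted sums of `U`. The sum telescopes, leaving the initial term and the terminal one,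
  -- which is zero.
  have h1 : ∀ t ∈ Finset.range n,
      ∑ J, ∑ c, R t J c * (r t J c + nextVal M e U t J c - U t J) =
        ∑ J, ∑ c, R t J c * r t J c + (∑ J, planInflow M own p R (t + 1) J * U (t + 1) J -
          ∑ J, planInflow M own p R t J * U t J) := by
    intro t ht
    rw [sum_planInflow_succ he, ← Finset.sum_sub_distrib, ← Finset.sum_add_distrib]
    refine Finset.sum_congr rfl fun J _ => ?_
    rw [← h.flow t (Finset.mem_range.1 ht) J, Finset.sum_mul, ← Finset.sum_sub_distrib,
      ← Finset.sum_add_distrib]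
    exact Finset.sum_congr rfl fun c _ => by ring
  rw [Finset.sum_congr rfl h1, Finset.sum_add_distrib,
    Finset.sum_range_sub (fun t => ∑ J, planInflow M own p R t J * U t J), sum_planInflow_zero,
    planReward]
  simp [hU]

/-- Weak duality: for a subsolution of the Bellman equation all slacks are non-negative, and so are
the weights of the plan. -/
theorem IsPlan.le_planReward (h : IsPlan M own p n R)
    (he : ∀ c o, own (e (c, o)).1 (e (c, o)).2 = c) (hU : ∀ J, U n J = 0)
    (hr : ∀ t < n, ∀ J c, U t J ≤ r t J c + nextVal M e U t J c) :
    ∑ s, p s * U 0 (Info.start s) ≤ planReward n r R := by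
  rw [h.planReward_eq he hU]
  refine le_add_of_nonneg_right (Finset.sum_nonneg fun t ht => Finset.sum_nonneg fun J _ =>
    Finset.sum_nonneg fun c _ => mul_nonneg (h.nonneg t (Finset.mem_range.1 ht) J c)
      (sub_nonneg.2 (hr t (Finset.mem_range.1 ht) J c)))

theorem IsPlan.planReward_le (h : IsPlan M own p n R)
    (he : ∀ c o, own (e (c, o)).1 (e (c, o)).2 = c) (hU : ∀ J, U n J = 0)
    (hr : ∀ t < n, ∀ J c, r t J c + nextVal M e U t J c ≤ U t J) :
    planReward n r R ≤ ∑ s, p s * U 0 (Info.start s) := by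
  rw [h.planReward_eq he hU]
  refine add_le_of_nonpos_right (Finset.sum_nonpos fun t ht => Finset.sum_nonpos fun J _ =>
    Finset.sum_nonpos fun c _ => mul_nonpos_of_nonneg_of_nonpos
      (h.nonneg t (Finset.mem_range.1 ht) J c) (sub_nonpos.2 (hr t (Finset.mem_range.1 ht) J c)))

/-- Backward induction: a strategy that minimizes the total reward, whatever the initial
distribution. -/
theorem exists_least_reply [Nonempty C] (hM : ∀ a b s s', 0 ≤ M a b s s')
    (he : ∀ c o, own (e (c, o)).1 (e (c, o)).2 = c) (n : ℕ)
    (r : ∀ t : ℕ, Info S A B t → C → ℝ) :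
    ∃ U : ∀ t : ℕ, Info S A B t → ℝ, (∀ J, U n J = 0) ∧
      (∀ t < n, ∀ J c, U t J ≤ r t J c + nextVal M e U t J c) ∧
      ∃ τ : Strategy S A B C, ∀ p : S → ℝ, (∀ s, 0 ≤ p s) →
        -- The equality holds for one `τ` and all `p`: the optimal actions depend on the information
        -- only, not on the initial distribution.
        planReward n r (plan M own p τ) = ∑ s, p s * U 0 (Info.start s) := by
  classical
  let U : ∀ t : ℕ, Info S A B t → ℝ := fun t J => leastVal M e r (n - t) t J
  have hU : ∀ t < n, ∀ J, U t J = ⨅ c, (r t J c + nextVal M e U t J c) := by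
    intro t ht J
    obtain ⟨m, hm⟩ : ∃ m, n - t = m + 1 := ⟨n - t - 1, by omega⟩
    have hm' : n - (t + 1) = m := by omega
    simp only [U, hm, leastVal, nextVal, hm']
  have h0 : ∀ J, U n J = 0 := fun J => by simp [U, leastVal]
  have h1 : ∀ (t : ℕ) J, ∃ c, r t J c + nextVal M e U t J c =
      ⨅ c, (r t J c + nextVal M e U t J c) := fun t J => exists_eq_ciInf_of_finite
  choose c hc using h1
  refine ⟨U, h0, fun t ht J c => ?_, fun t J => stdSimplex.vertex (c t J), fun p hp => ?_⟩
  · rw [hU t ht J]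
    exact ciInf_le (Set.finite_range _).bddBelow c
  · rw [(isPlan_plan hM hp _).planReward_eq he h0, add_eq_left]
    refine Finset.sum_eq_zero fun t ht => Finset.sum_eq_zero fun J _ =>
      Finset.sum_eq_zero fun c' _ => ?_
    -- Complementary slackness: the chosen action has slack zero, and every other action has plan
    -- weight zero.
    by_cases h : c' = c t J
    · rw [h, hc, hU t (Finset.mem_range.1 ht), sub_self, mul_zero]
    · have : (stdSimplex.vertex (S := ℝ) (c t J)) c' = 0 := by simp [h]
      rw [plan, this, mul_zero, zero_mul]

/-- Minimization for the negated reward. -/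
theorem exists_greatest_reply [Nonempty C] (hM : ∀ a b s s', 0 ≤ M a b s s')
    (he : ∀ c o, own (e (c, o)).1 (e (c, o)).2 = c) (n : ℕ)
    (r : ∀ t : ℕ, Info S A B t → C → ℝ) :
    ∃ U : ∀ t : ℕ, Info S A B t → ℝ, (∀ J, U n J = 0) ∧
      (∀ t < n, ∀ J c, r t J c + nextVal M e U t J c ≤ U t J) ∧
      ∃ τ : Strategy S A B C, ∀ p : S → ℝ, (∀ s, 0 ≤ p s) →
        planReward n r (plan M own p τ) = ∑ s, p s * U 0 (Info.start s) := by
  obtain ⟨U, h0, h1, τ, hτ⟩ := exists_least_reply hM he n (fun t J c => -r t J c)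
  refine ⟨fun t J => -U t J, fun J => by simp [h0], fun t ht J c => ?_, τ, fun p hp => ?_⟩
  · have h2 : nextVal M e (fun t J => -U t J) t J c = -nextVal M e U t J c := by
      simp [nextVal]
    have := h1 t ht J c
    rw [h2]
    linarith
  · have := hτ p hp
    simp only [planReward, mul_neg, Finset.sum_neg_distrib] at this ⊢
    linarith

end BestReply

/-! ### Payoffs as bilinear functions of realization plans -/

namespace Game

variable {K L A B : Type*} [Fintype K] [Fintype L]

theorem P_nonneg (g : Game K L A B) (a : A) (b : B) (k k' : K) : 0 ≤ g.P a b k k' :=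
  (g.P_mem a b k).1 k'

theorem Q_nonneg (g : Game K L A B) (a : A) (b : B) (l l' : L) : 0 ≤ g.Q a b l l' :=
  (g.Q_mem a b l).1 l'

theorem inflow1_eq (g : Game K L A B) (p : stdSimplex ℝ K) (R : ∀ t : ℕ, Info K A B t → A → ℝ)
    (t : ℕ) (I : Info K A B t) :
    g.inflow1 p R t I = planInflow g.P (fun a _ => a) p R t I := by
  cases t <;> rfl

theorem inflow2_eq (g : Game K L A B) (q : stdSimplex ℝ L) (S : ∀ t : ℕ, Info L A B t → B → ℝ)
    (t : ℕ) (J : Info L A B t) :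
    g.inflow2 q S t J = planInflow g.Q (fun _ b => b) q S t J := by
  cases t <;> rfl

theorem total_snoc (g : Game K L A B) (n : ℕ) (lam : ℝ) (ω : Play K L A B n) (k : K) (l : L)
    (a : A) (b : B) :
    g.total (n + 1) lam (Play.snocEquiv K L A B n (ω, ((k, l), (a, b)))) =
      g.total n lam ω + lam ^ n * g.G (ω.k (Fin.last n)) (ω.l (Fin.last n)) a b := by
  unfold total
  rw [Fin.sum_univ_castSucc]
  simp [Play.snocEquiv, Play.k, Play.l, Play.a, Play.b]

variable [Fintype A] [Fintype B]

/-- The realization plan of a strategy of player 1. -/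
abbrev plan1 (g : Game K L A B) (p : K → ℝ) (σ : Strategy K A B A) :
    ∀ t : ℕ, Info K A B t → A → ℝ :=
  plan g.P (fun a _ => a) p σ

/-- The realization plan of a strategy of player 2. -/
abbrev plan2 (g : Game K L A B) (q : L → ℝ) (τ : Strategy L A B B) :
    ∀ t : ℕ, Info L A B t → B → ℝ :=
  plan g.Q (fun _ b => b) q τ

/-- The payoff of a pair of realization plans. -/
def planPayoff (g : Game K L A B) (n : ℕ) (lam : ℝ) (R : ∀ t : ℕ, Info K A B t → A → ℝ)
    (S : ∀ t : ℕ, Info L A B t → B → ℝ) : ℝ :=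
  ∑ t ∈ Finset.range n, ∑ ω : Play K L A B t, ∑ a, ∑ b,
    R t ⟨ω.k, ω.a, ω.b⟩ a * S t ⟨ω.l, ω.a, ω.b⟩ b *
      (lam ^ t * g.G (ω.k (Fin.last t)) (ω.l (Fin.last t)) a b)

/-- The expected stage payoff as a function of player 1's information and action. -/
def reward1 (g : Game K L A B) (lam : ℝ) (S : ∀ t : ℕ, Info L A B t → B → ℝ) (t : ℕ)
    (I : Info K A B t) (a : A) : ℝ :=
  ∑ l : Fin (t + 1) → L, ∑ b, S t ⟨l, I.a, I.b⟩ b * (lam ^ t * g.G I.cur (l (Fin.last t)) a b)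

/-- The expected stage payoff as a function of player 2's information and action. -/
def reward2 (g : Game K L A B) (lam : ℝ) (R : ∀ t : ℕ, Info K A B t → A → ℝ) (t : ℕ)
    (J : Info L A B t) (b : B) : ℝ :=
  ∑ k : Fin (t + 1) → K, ∑ a, R t ⟨k, J.a, J.b⟩ a * (lam ^ t * g.G (k (Fin.last t)) J.cur a b)

/-- With `S` fixed, summing over player 2's states and actions leaves a one-person problem, to which
the dynamic programming results apply. -/
theorem planPayoff_eq_reward1 (g : Game K L A B) (n : ℕ) (lam : ℝ)
    (R : ∀ t : ℕ, Info K A B t → A → ℝ) (S : ∀ t : ℕ, Info L A B t → B → ℝ) :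
    g.planPayoff n lam R S = planReward n (g.reward1 lam S) R := by
  refine Finset.sum_congr rfl fun t _ => ?_
  rw [← (Info.equivProd K A B t).symm.sum_comp, Fintype.sum_prod_type, Fintype.sum_prod_type]
  refine Finset.sum_congr rfl fun k _ => ?_
  rw [Fintype.sum_prod_type, Finset.sum_comm]
  refine Finset.sum_congr rfl fun x _ => ?_
  rw [Finset.sum_comm]
  refine Finset.sum_congr rfl fun a _ => ?_
  simp only [reward1, Finset.mul_sum]
  refine Finset.sum_congr rfl fun l _ => Finset.sum_congr rfl fun b _ => ?_
  exact mul_assoc _ _ _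

theorem planPayoff_eq_reward2 (g : Game K L A B) (n : ℕ) (lam : ℝ)
    (R : ∀ t : ℕ, Info K A B t → A → ℝ) (S : ∀ t : ℕ, Info L A B t → B → ℝ) :
    g.planPayoff n lam R S = planReward n (g.reward2 lam R) S := by
  refine Finset.sum_congr rfl fun t _ => ?_
  rw [← (Info.equivProd L A B t).symm.sum_comp, Fintype.sum_prod_type, Fintype.sum_prod_type,
    Finset.sum_comm, Fintype.sum_prod_type]
  refine Finset.sum_congr rfl fun l _ => Finset.sum_congr rfl fun x _ => ?_
  simp only [reward2, Finset.mul_sum]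
  rw [Finset.sum_comm]
  have h : ∀ k : Fin (t + 1) → K, ∑ a, ∑ b, R t ⟨k, x.1, x.2⟩ a * S t ⟨l, x.1, x.2⟩ b *
      (lam ^ t * g.G (k (Fin.last t)) (l (Fin.last t)) a b) =
      ∑ b, ∑ a, S t ⟨l, x.1, x.2⟩ b * (R t ⟨k, x.1, x.2⟩ a *
        (lam ^ t * g.G (k (Fin.last t)) (l (Fin.last t)) a b)) := by
    intro k
    rw [Finset.sum_comm]
    exact Finset.sum_congr rfl fun b _ => Finset.sum_congr rfl fun a _ => by ring
  rw [Finset.sum_comm]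
  exact (Finset.sum_congr rfl fun k _ => h k).trans Finset.sum_comm

/-- Each factor of the probability belongs to exactly one player: initial law, transition and
behavior. The players' factors interact only through the public actions. -/
theorem prob_eq (g : Game K L A B) (n : ℕ) (p : stdSimplex ℝ K) (q : stdSimplex ℝ L)
    (σ : Strategy K A B A) (τ : Strategy L A B B) (ω : Play K L A B n) :
    g.prob n p q σ τ ω = planWeight g.P (fun a _ => a) p σ n ⟨ω.k, ω.a, ω.b⟩ *
      planWeight g.Q (fun _ b => b) q τ n ⟨ω.l, ω.a, ω.b⟩ := by
  induction n with
  | zero =>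
    simp [prob, planWeight, Info.cur]
  | succ n ih =>
    obtain ⟨⟨ω, ⟨k, l⟩, a, b⟩, rfl⟩ := (Play.snocEquiv K L A B n).surjective ω
    have h1 : (⟨(Play.snocEquiv K L A B n (ω, ((k, l), (a, b)))).k,
        (Play.snocEquiv K L A B n (ω, ((k, l), (a, b)))).a,
        (Play.snocEquiv K L A B n (ω, ((k, l), (a, b)))).b⟩ : Info K A B (n + 1)) =
        Info.extend ⟨ω.k, ω.a, ω.b⟩ a b k := rfl
    have h2 : (⟨(Play.snocEquiv K L A B n (ω, ((k, l), (a, b)))).l,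
        (Play.snocEquiv K L A B n (ω, ((k, l), (a, b)))).a,
        (Play.snocEquiv K L A B n (ω, ((k, l), (a, b)))).b⟩ : Info L A B (n + 1)) =
        Info.extend ⟨ω.l, ω.a, ω.b⟩ a b l := rfl
    rw [prob_snoc, ih, h1, h2]
    simp only [planWeight, Info.prev_extend, Info.cur_extend, Info.lastA_extend,
      Info.lastB_extend]
    simp only [Info.cur]
    ring

/-- By induction on the horizon: an additional stage contributes its own expected payoff and leaves
the expectation of the earlier ones unchanged. -/
theorem payoff_eq (g : Game K L A B) (n : ℕ) (lam : ℝ) (p : stdSimplex ℝ K) (q : stdSimplex ℝ L)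
    (σ : Strategy K A B A) (τ : Strategy L A B B) :
    g.payoff n lam p q σ τ = g.planPayoff n lam (g.plan1 p σ) (g.plan2 q τ) := by
  induction n with
  | zero => simp [payoff, expect, total, planPayoff]
  | succ n ih =>
    rw [planPayoff, Finset.sum_range_succ, ← planPayoff, ← ih]
    rw [payoff, expect, ← (Play.snocEquiv K L A B n).sum_comp, Fintype.sum_prod_type, payoff,
      expect, ← Finset.sum_add_distrib]
    refine Finset.sum_congr rfl fun ω _ => ?_
    have hP : ∀ a b k, ∑ k', g.P a b k k' = 1 := fun a b k => (g.P_mem a b k).2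
    have hQ : ∀ a b l, ∑ l', g.Q a b l l' = 1 := fun a b l => (g.Q_mem a b l).2
    have hs : ∀ I, ∑ a, σ n I a = 1 := fun I => (σ n I).2.2
    have ht : ∀ J, ∑ b, τ n J b = 1 := fun J => (τ n J).2.2
    -- The states reached after the last stage do not enter the payoff, so their transition
    -- probabilities sum out to one.
    have h1 : ∀ a b, ∑ x : K × L, g.prob (n + 1) p q σ τ (Play.snocEquiv K L A B n (ω, (x, (a, b)))) *
          g.total (n + 1) lam (Play.snocEquiv K L A B n (ω, (x, (a, b)))) =
        g.prob n p q σ τ ω * (σ n ⟨ω.k, ω.a, ω.b⟩ a * τ n ⟨ω.l, ω.a, ω.b⟩ b) *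
          (g.total n lam ω + lam ^ n * g.G (ω.k (Fin.last n)) (ω.l (Fin.last n)) a b) := by
      intro a b
      have h2 : ∑ x : K × L, g.P a b (ω.k (Fin.last n)) x.1 * g.Q a b (ω.l (Fin.last n)) x.2 = 1 := by
        rw [Fintype.sum_prod_type]
        simp only [← Finset.mul_sum, hP, hQ, mul_one]
      rw [← mul_one (_ * _ * _), ← h2, Finset.mul_sum]
      refine Finset.sum_congr rfl fun x _ => ?_
      rw [prob_snoc, total_snoc]
      ring
    rw [Fintype.sum_prod_type, Finset.sum_comm, Fintype.sum_prod_type]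
    simp only [h1]
    have h3 : g.prob n p q σ τ ω * g.total n lam ω = ∑ a, ∑ b,
        g.prob n p q σ τ ω * (σ n ⟨ω.k, ω.a, ω.b⟩ a * τ n ⟨ω.l, ω.a, ω.b⟩ b) *
          g.total n lam ω := by
      simp only [← Finset.mul_sum, ← Finset.sum_mul, hs, ht, mul_one]
    rw [h3, ← Finset.sum_add_distrib]
    refine Finset.sum_congr rfl fun a _ => ?_
    rw [← Finset.sum_add_distrib]
    refine Finset.sum_congr rfl fun b _ => ?_
    rw [prob_eq]
    simp only [plan1, plan2, plan]
    ring

/-! ## Existence of the values -/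

/-- Given each initial state the probabilities of the plays sum to one, so the marginal law of the
initial state is `p`. -/
theorem expect_k (g : Game K L A B) (n : ℕ) (p : stdSimplex ℝ K) (q : stdSimplex ℝ L)
    (σ : Strategy K A B A) (τ : Strategy L A B B) (μ : K → ℝ) :
    g.expect n p q σ τ (fun ω => μ (ω.k 0)) = ∑ k, p k * μ k := by
  classical
  rw [expect, ← Finset.sum_fiberwise (s := Finset.univ) (g := fun ω : Play K L A B n => ω.k 0)]
  refine Finset.sum_congr rfl fun k _ => ?_
  have h : g.expect n (stdSimplex.vertex k) q σ τ (fun _ => μ k) = μ k := by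
    rw [expect, ← Finset.sum_mul, sum_prob, one_mul]
  rw [← congrArg (p k * ·) h, ← sum_filter_k]
  refine Finset.sum_congr rfl fun ω hω => ?_
  rw [(Finset.mem_filter.1 hω).2]

theorem expect_l (g : Game K L A B) (n : ℕ) (p : stdSimplex ℝ K) (q : stdSimplex ℝ L)
    (σ : Strategy K A B A) (τ : Strategy L A B B) (ν : L → ℝ) :
    g.expect n p q σ τ (fun ω => ν (ω.l 0)) = ∑ l, q l * ν l := by
  classical
  rw [expect, ← Finset.sum_fiberwise (s := Finset.univ) (g := fun ω : Play K L A B n => ω.l 0)]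
  refine Finset.sum_congr rfl fun l _ => ?_
  have h : g.expect n p (stdSimplex.vertex l) σ τ (fun _ => ν l) = ν l := by
    rw [expect, ← Finset.sum_mul, sum_prob, one_mul]
  rw [← congrArg (q l * ·) h, ← sum_filter_l]
  refine Finset.sum_congr rfl fun ω hω => ?_
  rw [(Finset.mem_filter.1 hω).2]

theorem dualPayoff1_eq (g : Game K L A B) (n : ℕ) (lam : ℝ) (μ : K → ℝ) (q : stdSimplex ℝ L)
    (x : stdSimplex ℝ K × Strategy K A B A) (τ : Strategy L A B B) :
    g.dualPayoff1 n lam μ q x τ = ∑ k, x.1 k * μ k + g.payoff n lam x.1 q x.2 τ := by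
  rw [← g.expect_k n x.1 q x.2 τ μ, dualPayoff1, payoff]
  simp only [expect, mul_add, Finset.sum_add_distrib]

theorem dualPayoff2_eq (g : Game K L A B) (n : ℕ) (lam : ℝ) (p : stdSimplex ℝ K) (ν : L → ℝ)
    (σ : Strategy K A B A) (y : stdSimplex ℝ L × Strategy L A B B) :
    g.dualPayoff2 n lam p ν σ y = ∑ l, y.1 l * ν l + g.payoff n lam p y.1 σ y.2 := by
  rw [← g.expect_l n p y.1 σ y.2 ν, dualPayoff2, payoff]
  simp only [expect, mul_add, Finset.sum_add_distrib]

theorem planPayoff_congr (g : Game K L A B) {n : ℕ} {lam : ℝ}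
    {R R' : ∀ t : ℕ, Info K A B t → A → ℝ} {S S' : ∀ t : ℕ, Info L A B t → B → ℝ}
    (hR : ∀ t < n, ∀ I a, R t I a = R' t I a) (hS : ∀ t < n, ∀ J b, S t J b = S' t J b) :
    g.planPayoff n lam R S = g.planPayoff n lam R' S' := by
  refine Finset.sum_congr rfl fun t ht => ?_
  simp only [hR t (Finset.mem_range.1 ht), hS t (Finset.mem_range.1 ht)]

/-- The payoff of a game in which the players may also choose their initial distributions, as a
function of the initial distributions and realization plans. -/
def extendedPayoff (g : Game K L A B) (n : ℕ) (lam : ℝ) (μ : K → ℝ) (ν : L → ℝ)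
    (c : (K → ℝ) × (∀ t : ℕ, Info K A B t → A → ℝ))
    (d : (L → ℝ) × (∀ t : ℕ, Info L A B t → B → ℝ)) : ℝ :=
  ∑ k, c.1 k * μ k + ∑ l, d.1 l * ν l + g.planPayoff n lam c.2 d.2

/-- The term in `ν` is constant in this argument, so the function is affine rather than linear;
hence the condition `x + y = 1`. -/
theorem extendedPayoff_combo_left (g : Game K L A B) (n : ℕ) (lam : ℝ) (μ : K → ℝ) (ν : L → ℝ)
    (c c' : (K → ℝ) × (∀ t : ℕ, Info K A B t → A → ℝ))
    (d : (L → ℝ) × (∀ t : ℕ, Info L A B t → B → ℝ)) {x y : ℝ} (hxy : x + y = 1) :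
    g.extendedPayoff n lam μ ν (x • c + y • c') d =
      x • g.extendedPayoff n lam μ ν c d + y • g.extendedPayoff n lam μ ν c' d := by
  have h : ∑ l, d.1 l * ν l = x * ∑ l, d.1 l * ν l + y * ∑ l, d.1 l * ν l := by
    rw [← add_mul, hxy, one_mul]
  rw [extendedPayoff, h]
  simp only [extendedPayoff, planPayoff, Prod.fst_add, Prod.smul_fst, Prod.snd_add,
    Prod.smul_snd, Pi.add_apply, Pi.smul_apply, smul_eq_mul, add_mul, mul_add,
    Finset.sum_add_distrib, Finset.mul_sum, mul_assoc]
  ring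

theorem extendedPayoff_combo_right (g : Game K L A B) (n : ℕ) (lam : ℝ) (μ : K → ℝ) (ν : L → ℝ)
    (c : (K → ℝ) × (∀ t : ℕ, Info K A B t → A → ℝ))
    (d d' : (L → ℝ) × (∀ t : ℕ, Info L A B t → B → ℝ)) {x y : ℝ} (hxy : x + y = 1) :
    g.extendedPayoff n lam μ ν c (x • d + y • d') =
      x • g.extendedPayoff n lam μ ν c d + y • g.extendedPayoff n lam μ ν c d' := by
  have h : ∑ k, c.1 k * μ k = x * ∑ k, c.1 k * μ k + y * ∑ k, c.1 k * μ k := by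
    rw [← add_mul, hxy, one_mul]
  rw [extendedPayoff, h]
  simp only [extendedPayoff, planPayoff, Prod.fst_add, Prod.smul_fst, Prod.snd_add,
    Prod.smul_snd, Pi.add_apply, Pi.smul_apply, smul_eq_mul, add_mul, mul_add,
    Finset.sum_add_distrib, Finset.mul_sum, mul_assoc, mul_left_comm _ x, mul_left_comm _ y]
  ring

/-- One statement for three games: `Cp` and `Cq` are singletons where the initial distribution is
given, and one of them is the whole simplex in a dual game. -/
theorem exists_isGameValue (g : Game K L A B) (n : ℕ) (lam : ℝ) (μ : K → ℝ) (ν : L → ℝ)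
    [Nonempty A] [Nonempty B] {X Y : Type*} [Nonempty X] [Nonempty Y]
    {pX : X → stdSimplex ℝ K} {σX : X → Strategy K A B A}
    {qY : Y → stdSimplex ℝ L} {τY : Y → Strategy L A B B} {Cp : Set (K → ℝ)} {Cq : Set (L → ℝ)}
    (hp : IsClosed Cp) (cp : Convex ℝ Cp) (hq : IsClosed Cq) (cq : Convex ℝ Cq)
    (hp1 : Cp ⊆ stdSimplex ℝ K) (hq1 : Cq ⊆ stdSimplex ℝ L)
    (hX : ∀ x, ⇑(pX x) ∈ Cp) (hY : ∀ y, ⇑(qY y) ∈ Cq)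
    (sX : ∀ p ∈ Cp, ∀ σ, ∃ x, ⇑(pX x) = p ∧ σX x = σ)
    (sY : ∀ q ∈ Cq, ∀ τ, ∃ y, ⇑(qY y) = q ∧ τY y = τ) :
    ∃ v, IsGameValue (fun x y => ∑ k, pX x k * μ k + ∑ l, qY y l * ν l +
      g.payoff n lam (pX x) (qY y) (σX x) (τY y)) v := by
  refine exists_isGameValue_of_represented (C := planSet g.P (fun a _ => a) Cp)
    (D := planSet g.Q (fun _ b => b) Cq) (f := g.extendedPayoff n lam μ ν)
    (φ := fun x => (pX x, g.plan1 (pX x) (σX x))) (ψ := fun y => (qY y, g.plan2 (qY y) (τY y)))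
    (isCompact_planSet (fun a b k k' => (mem_Icc_of_mem_stdSimplex (g.P_mem a b k) k').2) hp hp1)
    (isCompact_planSet (fun a b l l' => (mem_Icc_of_mem_stdSimplex (g.Q_mem a b l) l').2) hq hq1)
    (convex_planSet cp) (convex_planSet cq) (fun d => ?_) (fun c => ?_) (fun d => ?_) (fun c => ?_)
    (fun x => ⟨hX x, fun n => isPlan_plan g.P_nonneg (pX x).2.1 _⟩)
    (fun y => ⟨hY y, fun n => isPlan_plan g.Q_nonneg (qY y).2.1 _⟩)
    (fun x y => ?_) ?_ ?_
  · unfold extendedPayoff planPayoff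
    fun_prop
  · unfold extendedPayoff planPayoff
    fun_prop
  · refine ConcaveOn.quasiconcaveOn ⟨convex_planSet cp, fun c _ c' _ x y _ _ hxy => ?_⟩
    exact (g.extendedPayoff_combo_left n lam μ ν c c' d hxy).ge
  · refine ConvexOn.quasiconvexOn ⟨convex_planSet cq, fun d _ d' _ x y _ _ hxy => ?_⟩
    exact (g.extendedPayoff_combo_right n lam μ ν c d d' hxy).le
  · rw [payoff_eq]
    rfl
  -- The plan of the induced strategy agrees with `R` before stage `n`, which is all that the payoff
  -- sees.
  · rintro ⟨p, R⟩ ⟨hpc, hR⟩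
    obtain ⟨σ, hσ⟩ := (hR n).exists_induces
    obtain ⟨x, rfl, rfl⟩ := sX p hpc σ
    exact ⟨x, fun d => congrArg (_ + ·) (g.planPayoff_congr ((hR n).eq_plan hσ)
      fun _ _ _ _ => rfl)⟩
  · rintro ⟨q, S⟩ ⟨hqc, hS⟩
    obtain ⟨τ, hτ⟩ := (hS n).exists_induces
    obtain ⟨y, rfl, rfl⟩ := sY q hqc τ
    exact ⟨y, fun c => congrArg (_ + ·) (g.planPayoff_congr (fun _ _ _ _ => rfl)
      ((hS n).eq_plan hτ))⟩

theorem exists_isGameValue_payoff [Nonempty A] [Nonempty B] (g : Game K L A B) (n : ℕ) (lam : ℝ)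
    (p : stdSimplex ℝ K) (q : stdSimplex ℝ L) : ∃ v, IsGameValue (g.payoff n lam p q) v := by
  have h := g.exists_isGameValue n lam 0 0 (pX := fun _ : Strategy K A B A => p) (σX := id)
    (qY := fun _ : Strategy L A B B => q) (τY := id)
    (isClosed_singleton (x := (p : K → ℝ))) (convex_singleton _)
    (isClosed_singleton (x := (q : L → ℝ))) (convex_singleton _)
    (by rintro _ rfl; exact p.2) (by rintro _ rfl; exact q.2) (fun _ => rfl) (fun _ => rfl)
    (fun _ h σ => ⟨σ, h.symm, rfl⟩) (fun _ h τ => ⟨τ, h.symm, rfl⟩)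
  simpa using h

theorem exists_isGameValue_dualPayoff1 [Nonempty A] [Nonempty B] (g : Game K L A B) (n : ℕ)
    (lam : ℝ) (μ : K → ℝ) (p : stdSimplex ℝ K) (q : stdSimplex ℝ L) :
    ∃ w, IsGameValue (g.dualPayoff1 n lam μ q) w := by
  have : Nonempty (stdSimplex ℝ K) := ⟨p⟩
  have h := g.exists_isGameValue n lam μ 0 (pX := fun x : stdSimplex ℝ K × Strategy K A B A => x.1)
    (σX := fun x => x.2) (qY := fun _ : Strategy L A B B => q) (τY := id)
    (isClosed_stdSimplex ℝ K) (convex_stdSimplex ℝ K)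
    (isClosed_singleton (x := (q : L → ℝ))) (convex_singleton _)
    subset_rfl (by rintro _ rfl; exact q.2) (fun x => x.1.2) (fun _ => rfl)
    (fun p hp σ => ⟨(⟨p, hp⟩, σ), rfl, rfl⟩) (fun _ h τ => ⟨τ, h.symm, rfl⟩)
  have e : g.dualPayoff1 n lam μ q = fun x τ => ∑ k, x.1 k * μ k + g.payoff n lam x.1 q x.2 τ :=
    funext fun x => funext fun τ => g.dualPayoff1_eq n lam μ q x τ
  rw [e]
  simpa using h

theorem exists_isGameValue_dualPayoff2 [Nonempty A] [Nonempty B] (g : Game K L A B) (n : ℕ)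
    (lam : ℝ) (ν : L → ℝ) (p : stdSimplex ℝ K) (q : stdSimplex ℝ L) :
    ∃ w, IsGameValue (g.dualPayoff2 n lam p ν) w := by
  have : Nonempty (stdSimplex ℝ L) := ⟨q⟩
  have h := g.exists_isGameValue n lam 0 ν (pX := fun _ : Strategy K A B A => p) (σX := id)
    (qY := fun y : stdSimplex ℝ L × Strategy L A B B => y.1) (τY := fun y => y.2)
    (isClosed_singleton (x := (p : K → ℝ))) (convex_singleton _)
    (isClosed_stdSimplex ℝ L) (convex_stdSimplex ℝ L)
    (by rintro _ rfl; exact p.2) subset_rfl (fun _ => rfl) (fun y => y.1.2)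
    (fun _ h σ => ⟨σ, h.symm, rfl⟩) (fun q hq τ => ⟨(⟨q, hq⟩, τ), rfl, rfl⟩)
  have e : g.dualPayoff2 n lam p ν = fun σ y => ∑ l, y.1 l * ν l + g.payoff n lam p y.1 σ y.2 :=
    funext fun σ => funext fun y => g.dualPayoff2_eq n lam p ν σ y
  rw [e]
  simpa using h

/-! ## The linear programs and best replies -/

variable {g : Game K L A B} {n : ℕ} {lam : ℝ} {p : stdSimplex ℝ K} {q : stdSimplex ℝ L}
  {R : ∀ t : ℕ, Info K A B t → A → ℝ} {U : ∀ t : ℕ, Info L A B t → ℝ}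
  {S : ∀ t : ℕ, Info L A B t → B → ℝ} {Z : ∀ t : ℕ, Info K A B t → ℝ}
  {σ : Strategy K A B A} {τ : Strategy L A B B}

theorem Feasible1.isPlan (h : g.Feasible1 n lam p R U) : IsPlan g.P (fun a _ => a) p n R :=
  ⟨fun t ht I => (h.flow t ht I).trans (g.inflow1_eq p R t I), h.nonneg⟩

theorem Feasible2.isPlan (h : g.Feasible2 n lam q S Z) : IsPlan g.Q (fun _ b => b) q n S :=
  ⟨fun t ht J => (h.flow t ht J).trans (g.inflow2_eq q S t J), h.nonneg⟩

theorem induces1_iff : g.Induces1 n p R σ ↔ PlanInduces g.P (fun a _ => a) p n R σ := by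
  simp only [Induces1, PlanInduces, inflow1_eq]

theorem induces2_iff : g.Induces2 n q S τ ↔ PlanInduces g.Q (fun _ b => b) q n S τ := by
  simp only [Induces2, PlanInduces, inflow2_eq]

theorem induces1_plan1 : g.Induces1 n p (g.plan1 p σ) σ := by
  rw [induces1_iff]
  intro t _ I h a
  rw [planInflow_plan] at h ⊢
  exact (mul_div_cancel_left₀ _ h).symm

theorem induces2_plan2 : g.Induces2 n q (g.plan2 q τ) τ := by
  rw [induces2_iff]
  intro t _ J h b
  rw [planInflow_plan] at h ⊢
  exact (mul_div_cancel_left₀ _ h).symm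

/-- The payoff depends on `R` only, so all strategies induced by it are interchangeable, against
every `q` and `τ`. -/
theorem payoff_eq_of_induces1 (h : IsPlan g.P (fun a _ => a) p n R) (hσ : g.Induces1 n p R σ)
    (q : stdSimplex ℝ L) (τ : Strategy L A B B) :
    g.payoff n lam p q σ τ = g.planPayoff n lam R (g.plan2 q τ) := by
  rw [payoff_eq]
  exact g.planPayoff_congr (fun t ht I a => (h.eq_plan (induces1_iff.1 hσ) t ht I a).symm)
    fun _ _ _ _ => rfl

theorem payoff_eq_of_induces2 (h : IsPlan g.Q (fun _ b => b) q n S) (hτ : g.Induces2 n q S τ)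
    (p : stdSimplex ℝ K) (σ : Strategy K A B A) :
    g.payoff n lam p q σ τ = g.planPayoff n lam (g.plan1 p σ) S := by
  rw [payoff_eq]
  exact g.planPayoff_congr (fun _ _ _ _ => rfl)
    fun t ht J b => (h.eq_plan (induces2_iff.1 hτ) t ht J b).symm

/-- The first constraint is the Bellman inequality for player 2's problem against `R`. It does not
involve `q`, so the bound holds for every initial distribution. -/
theorem Feasible1.objective1_le_payoff (h : g.Feasible1 n lam p R U) (hσ : g.Induces1 n p R σ)
    (q : stdSimplex ℝ L) (τ : Strategy L A B B) : objective1 q U ≤ g.payoff n lam p q σ τ := by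
  rw [payoff_eq_of_induces1 h.isPlan hσ, planPayoff_eq_reward2]
  exact (isPlan_plan g.Q_nonneg q.2.1 τ).le_planReward (e := Equiv.prodComm B A)
    (fun _ _ => rfl) h.terminal h.payoff_le

theorem Feasible2.payoff_le_objective2 (h : g.Feasible2 n lam q S Z) (hτ : g.Induces2 n q S τ)
    (p : stdSimplex ℝ K) (σ : Strategy K A B A) : g.payoff n lam p q σ τ ≤ objective2 p Z := by
  rw [payoff_eq_of_induces2 h.isPlan hτ, planPayoff_eq_reward1]
  exact (isPlan_plan g.P_nonneg p.2.1 σ).planReward_le (e := Equiv.refl (A × B))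
    (fun _ _ => rfl) h.terminal h.le_payoff

/-- For each plan of player 1 there are feasible `U` for which the objective is the payoff against
a best reply, whatever the initial distribution of player 2. -/
theorem exists_feasible1 [Nonempty B] (h : IsPlan g.P (fun a _ => a) p n R)
    (hσ : g.Induces1 n p R σ) : ∃ U, g.Feasible1 n lam p R U ∧
      ∃ τ, ∀ q : stdSimplex ℝ L, g.payoff n lam p q σ τ = objective1 q U := by
  obtain ⟨U, h0, h1, τ, hτ⟩ := exists_least_reply (M := g.Q) (own := fun _ b => b)
    (e := Equiv.prodComm B A) g.Q_nonneg (fun _ _ => rfl) n (g.reward2 lam R)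
  refine ⟨U, ⟨h1, fun t ht I => (h.flow t ht I).trans (g.inflow1_eq p R t I).symm, h0, h.nonneg⟩,
    τ, fun q => ?_⟩
  rw [payoff_eq_of_induces1 h hσ, planPayoff_eq_reward2]
  exact hτ q q.2.1

theorem exists_feasible2 [Nonempty A] (h : IsPlan g.Q (fun _ b => b) q n S)
    (hτ : g.Induces2 n q S τ) : ∃ Z, g.Feasible2 n lam q S Z ∧
      ∃ σ, ∀ p : stdSimplex ℝ K, g.payoff n lam p q σ τ = objective2 p Z := by
  obtain ⟨Z, h0, h1, σ, hσ⟩ := exists_greatest_reply (M := g.P) (own := fun a _ => a)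
    (e := Equiv.refl (A × B)) g.P_nonneg (fun _ _ => rfl) n (g.reward1 lam S)
  refine ⟨Z, ⟨h1, fun t ht I => (h.flow t ht I).trans (g.inflow2_eq q S t I).symm, h0, h.nonneg⟩,
    σ, fun p => ?_⟩
  rw [payoff_eq_of_induces2 h hτ, planPayoff_eq_reward1]
  exact hσ p p.2.1

/-- Turns bounds valid for all distributions into bounds for each initial state. -/
theorem objective1_vertex [DecidableEq L] (l : L) (U : ∀ t : ℕ, Info L A B t → ℝ) :
    objective1 (stdSimplex.vertex l) U = U 0 (Info.start l) := by
  simp [objective1, Pi.single_apply]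

theorem objective2_vertex [DecidableEq K] (k : K) (Z : ∀ t : ℕ, Info K A B t → ℝ) :
    objective2 (stdSimplex.vertex k) Z = Z 0 (Info.start k) := by
  simp [objective2, Pi.single_apply]

/-! ## Player 1's linear program -/

/-- Any feasible objective is guaranteed by an induced strategy, hence at most the maxmin. The plan
of an optimal strategy, completed by the Bellman solution, attains it. -/
theorem isGreatest_objective1 [Nonempty A] [Nonempty B] {v : ℝ}
    (hv : IsGameValue (g.payoff n lam p q) v) :
    IsGreatest {c | ∃ R U, g.Feasible1 n lam p R U ∧ c = objective1 q U} v := by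
  obtain ⟨⟨hmin, ⟨σ, hσ⟩, hmax⟩, -⟩ := hv
  have upper : ∀ R U, g.Feasible1 n lam p R U → objective1 q U ≤ v := by
    intro R U h
    obtain ⟨σ', hσ'⟩ := h.isPlan.exists_induces
    rw [← induces1_iff] at hσ'
    obtain ⟨m, hm⟩ := hmin σ'
    refine le_trans ?_ (hmax ⟨σ', hm⟩)
    obtain ⟨τ, rfl⟩ := hm.1
    exact h.objective1_le_payoff hσ' q τ
  refine ⟨?_, ?_⟩
  · obtain ⟨U, hU, τ, hτ⟩ := exists_feasible1 (lam := lam) (n := n) (σ := σ)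
      (isPlan_plan g.P_nonneg p.2.1 σ) induces1_plan1
    exact ⟨_, U, hU, le_antisymm ((hσ.2 ⟨τ, rfl⟩).trans (hτ q).le) (upper _ U hU)⟩
  · rintro _ ⟨R, U, h, rfl⟩
    exact upper R U h

/-- A single `τ` attains the minimum for all initial states at once, because it attains the bound
for every distribution. -/
theorem isAlpha_of_reply [DecidableEq L] (h : g.Feasible1 n lam p R U) (hσ : g.Induces1 n p R σ)
    (hτ : ∀ q : stdSimplex ℝ L, g.payoff n lam p q σ τ = objective1 q U) (l : L) :
    g.IsAlpha n lam p σ l (U 0 (Info.start l)) := by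
  rw [← objective1_vertex l U]
  refine ⟨⟨τ, hτ _⟩, ?_⟩
  rintro _ ⟨τ', rfl⟩
  exact h.objective1_le_payoff hσ _ τ'

theorem IsOptimal1.objective1_eq {v : ℝ} (h : g.IsOptimal1 n lam p q R U)
    (hv : IsGreatest {c | ∃ R U, g.Feasible1 n lam p R U ∧ c = objective1 q U} v) :
    objective1 q U = v := by
  obtain ⟨R', U', h', rfl⟩ := hv.1
  exact le_antisymm (hv.2 ⟨R, U, h.1, rfl⟩) (h.2 R' U' h')

theorem IsOptimal1.isSecurity1 {v : ℝ} (h : g.IsOptimal1 n lam p q R U)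
    (hσ : g.Induces1 n p R σ) (hv : IsMaxmin (g.payoff n lam p q) v)
    (hU : objective1 q U = v) : IsSecurity1 (g.payoff n lam p q) σ := by
  obtain ⟨m, hm⟩ := hv.1 σ
  have h1 : m ≤ v := hv.2.2 ⟨σ, hm⟩
  have h2 : v ≤ m := by
    obtain ⟨τ, rfl⟩ := hm.1
    exact hU.symm.le.trans (h.1.objective1_le_payoff hσ q τ)
  exact ⟨v, hv, le_antisymm h1 h2 ▸ hm⟩

/-- The Bellman solution `U'` for the same `R` dominates `U` at each initial state, while optimality
forbids a larger objective. So the objectives agree, `U'` is optimal too, and the two coincide at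
each state of positive probability. -/
theorem IsOptimal1.exists_isAlpha [DecidableEq L] [Nonempty B] (h : g.IsOptimal1 n lam p q R U)
    (hσ : g.Induces1 n p R σ) :
    (∀ l, ∃ m, g.IsAlpha n lam p σ l m ∧ U 0 (Info.start l) ≤ m ∧
      (0 < q l → U 0 (Info.start l) = m)) ∧
    ∃ U', g.IsOptimal1 n lam p q R U' ∧ ∀ l, g.IsAlpha n lam p σ l (U' 0 (Info.start l)) := by
  obtain ⟨U', hU', τ, hτ⟩ := exists_feasible1 (lam := lam) h.1.isPlan hσ
  have hle : ∀ l, U 0 (Info.start l) ≤ U' 0 (Info.start l) := fun l => by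
    rw [← objective1_vertex l U, ← objective1_vertex l U', ← hτ]
    exact h.1.objective1_le_payoff hσ _ τ
  have hle' : ∀ l ∈ Finset.univ, q l * U 0 (Info.start l) ≤ q l * U' 0 (Info.start l) :=
    fun l _ => mul_le_mul_of_nonneg_left (hle l) (q.2.1 l)
  have heq : objective1 q U = objective1 q U' :=
    le_antisymm (Finset.sum_le_sum hle') (h.2 R U' hU')
  refine ⟨fun l => ⟨_, isAlpha_of_reply hU' hσ hτ l, hle l, fun hl => ?_⟩,
    U', ⟨hU', fun R'' U'' h'' => (h.2 R'' U'' h'').trans heq.le⟩, isAlpha_of_reply hU' hσ hτ⟩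
  exact mul_left_cancel₀ hl.ne' ((Finset.sum_eq_sum_iff_of_le hle').1 heq l (Finset.mem_univ l))

/-- For the upper bound, player 2 may choose `q` itself in the dual game, which leaves the primal
payoff plus a constant. For equality at `ν = -U`, a strategy induced by `R` guarantees at least `∑
q' U` for every `q'`, cancelling the initial term; thus the dual value is at least `0`, while `-∑ q
ν` is the objective `v`. -/
theorem IsOptimal1.isSpecialNu [Nonempty A] [Nonempty B] {v : ℝ}
    (h : g.IsOptimal1 n lam p q R U) (hv : IsMaxmin (g.payoff n lam p q) v)
    (hU : objective1 q U = v) : g.IsSpecialNu n lam p q v (fun l => -U 0 (Info.start l)) := by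
  have upper : ∀ (ν : L → ℝ) w, IsGameValue (g.dualPayoff2 n lam p ν) w →
      w - ∑ l, q l * ν l ≤ v := by
    intro ν w hw
    obtain ⟨σ, hσ⟩ := hw.1.2.1
    obtain ⟨m, hm⟩ := hv.1 σ
    have h1 : m ≤ v := hv.2.2 ⟨σ, hm⟩
    obtain ⟨τ, rfl⟩ := hm.1
    have h2 := hσ.2 ⟨(q, τ), rfl⟩
    simp only [dualPayoff2_eq] at h2 h1
    linarith
  refine ⟨fun ν => ?_, ?_⟩
  · obtain ⟨w, hw⟩ := g.exists_isGameValue_dualPayoff2 n lam ν p q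
    exact ⟨w, hw, upper ν w hw⟩
  · obtain ⟨w, hw⟩ := g.exists_isGameValue_dualPayoff2 n lam (fun l => -U 0 (Info.start l)) p q
    refine ⟨w, hw, le_antisymm (upper _ w hw) ?_⟩
    obtain ⟨σ, hσ⟩ := h.1.isPlan.exists_induces
    rw [← induces1_iff] at hσ
    obtain ⟨m, hm⟩ := hw.1.1 σ
    have h1 : m ≤ w := hw.1.2.2 ⟨σ, hm⟩
    have h2 : 0 ≤ m := by
      obtain ⟨y, rfl⟩ := hm.1
      have h3 := h.1.objective1_le_payoff hσ y.1 y.2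
      simp only [dualPayoff2_eq, mul_neg, Finset.sum_neg_distrib]
      simp only [objective1] at h3
      linarith
    simp only [objective1] at hU
    simp only [mul_neg, Finset.sum_neg_distrib, hU]
    linarith

/-! ## Player 2's linear program -/

/-- Supersolutions bound player 1's best reply from above, and the plan of an optimal strategy of
player 2 attains the minmax. -/
theorem isLeast_objective2 [Nonempty A] [Nonempty B] {v : ℝ}
    (hv : IsGameValue (g.payoff n lam p q) v) :
    IsLeast {c | ∃ S Z, g.Feasible2 n lam q S Z ∧ c = objective2 p Z} v := by
  obtain ⟨-, ⟨hmax, ⟨τ, hτ⟩, hmin⟩⟩ := hv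
  have lower : ∀ S Z, g.Feasible2 n lam q S Z → v ≤ objective2 p Z := by
    intro S Z h
    obtain ⟨τ', hτ'⟩ := h.isPlan.exists_induces
    rw [← induces2_iff] at hτ'
    obtain ⟨m, hm⟩ := hmax τ'
    refine (hmin ⟨τ', hm⟩).trans ?_
    obtain ⟨σ, rfl⟩ := hm.1
    exact h.payoff_le_objective2 hτ' p σ
  refine ⟨?_, ?_⟩
  · obtain ⟨Z, hZ, σ, hσ⟩ := exists_feasible2 (lam := lam) (n := n) (τ := τ)
      (isPlan_plan g.Q_nonneg q.2.1 τ) induces2_plan2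
    exact ⟨_, Z, hZ, le_antisymm (lower _ Z hZ) ((hσ p).ge.trans (hτ.2 ⟨σ, rfl⟩))⟩
  · rintro _ ⟨S, Z, h, rfl⟩
    exact lower S Z h

theorem isBeta_of_reply [DecidableEq K] (h : g.Feasible2 n lam q S Z) (hτ : g.Induces2 n q S τ)
    (hσ : ∀ p : stdSimplex ℝ K, g.payoff n lam p q σ τ = objective2 p Z) (k : K) :
    g.IsBeta n lam q τ k (Z 0 (Info.start k)) := by
  rw [← objective2_vertex k Z]
  refine ⟨⟨σ, hσ _⟩, ?_⟩
  rintro _ ⟨σ', rfl⟩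
  exact h.payoff_le_objective2 hτ _ σ'

theorem IsOptimal2.objective2_eq {v : ℝ} (h : g.IsOptimal2 n lam p q S Z)
    (hv : IsLeast {c | ∃ S Z, g.Feasible2 n lam q S Z ∧ c = objective2 p Z} v) :
    objective2 p Z = v := by
  obtain ⟨S', Z', h', rfl⟩ := hv.1
  exact le_antisymm (h.2 S' Z' h') (hv.2 ⟨S, Z, h.1, rfl⟩)

theorem IsOptimal2.isSecurity2 {v : ℝ} (h : g.IsOptimal2 n lam p q S Z)
    (hτ : g.Induces2 n q S τ) (hv : IsMinmax (g.payoff n lam p q) v)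
    (hZ : objective2 p Z = v) : IsSecurity2 (g.payoff n lam p q) τ := by
  obtain ⟨m, hm⟩ := hv.1 τ
  have h1 : v ≤ m := hv.2.2 ⟨τ, hm⟩
  have h2 : m ≤ v := by
    obtain ⟨σ, rfl⟩ := hm.1
    exact (h.1.payoff_le_objective2 hτ p σ).trans hZ.le
  exact ⟨v, hv, le_antisymm h2 h1 ▸ hm⟩

/-- Here the Bellman solution lies below `Z` at each initial state, and minimality forces equality
of the weighted sums. -/
theorem IsOptimal2.exists_isBeta [DecidableEq K] [Nonempty A] (h : g.IsOptimal2 n lam p q S Z)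
    (hτ : g.Induces2 n q S τ) :
    (∀ k, ∃ m, g.IsBeta n lam q τ k m ∧ m ≤ Z 0 (Info.start k) ∧
      (0 < p k → Z 0 (Info.start k) = m)) ∧
    ∃ Z', g.IsOptimal2 n lam p q S Z' ∧ ∀ k, g.IsBeta n lam q τ k (Z' 0 (Info.start k)) := by
  obtain ⟨Z', hZ', σ, hσ⟩ := exists_feasible2 (lam := lam) h.1.isPlan hτ
  have hle : ∀ k, Z' 0 (Info.start k) ≤ Z 0 (Info.start k) := fun k => by
    rw [← objective2_vertex k Z, ← objective2_vertex k Z', ← hσ]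
    exact h.1.payoff_le_objective2 hτ _ σ
  have hle' : ∀ k ∈ Finset.univ, p k * Z' 0 (Info.start k) ≤ p k * Z 0 (Info.start k) :=
    fun k _ => mul_le_mul_of_nonneg_left (hle k) (p.2.1 k)
  have heq : objective2 p Z' = objective2 p Z :=
    le_antisymm (Finset.sum_le_sum hle') (h.2 S Z' hZ')
  refine ⟨fun k => ⟨_, isBeta_of_reply hZ' hτ hσ k, hle k, fun hk => ?_⟩,
    Z', ⟨hZ', fun S'' Z'' h'' => heq.le.trans (h.2 S'' Z'' h'')⟩, isBeta_of_reply hZ' hτ hσ⟩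
  exact (mul_left_cancel₀ hk.ne'
    ((Finset.sum_eq_sum_iff_of_le hle').1 heq k (Finset.mem_univ k))).symm

/-- Player 1 may choose `p` itself in the dual game, which bounds every dual expression below by
`v`. At `μ = -Z` the induced strategy of player 2 keeps the dual payoff at most `0` for every
initial distribution. -/
theorem IsOptimal2.isSpecialMu [Nonempty A] [Nonempty B] {v : ℝ}
    (h : g.IsOptimal2 n lam p q S Z) (hv : IsMinmax (g.payoff n lam p q) v)
    (hZ : objective2 p Z = v) : g.IsSpecialMu n lam p q v (fun k => -Z 0 (Info.start k)) := by
  have lower : ∀ (μ : K → ℝ) w, IsGameValue (g.dualPayoff1 n lam μ q) w →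
      v ≤ w - ∑ k, p k * μ k := by
    intro μ w hw
    obtain ⟨τ, hτ⟩ := hw.2.2.1
    obtain ⟨m, hm⟩ := hv.1 τ
    have h1 : v ≤ m := hv.2.2 ⟨τ, hm⟩
    obtain ⟨σ, rfl⟩ := hm.1
    have h2 := hτ.2 ⟨(p, σ), rfl⟩
    simp only [dualPayoff1_eq] at h2 h1
    linarith
  refine ⟨fun μ => ?_, ?_⟩
  · obtain ⟨w, hw⟩ := g.exists_isGameValue_dualPayoff1 n lam μ p q
    exact ⟨w, hw, lower μ w hw⟩
  · obtain ⟨w, hw⟩ := g.exists_isGameValue_dualPayoff1 n lam (fun k => -Z 0 (Info.start k)) p q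
    refine ⟨w, hw, le_antisymm ?_ (lower _ w hw)⟩
    obtain ⟨τ, hτ⟩ := h.1.isPlan.exists_induces
    rw [← induces2_iff] at hτ
    obtain ⟨m, hm⟩ := hw.2.1 τ
    have h1 : w ≤ m := hw.2.2.2 ⟨τ, hm⟩
    have h2 : m ≤ 0 := by
      obtain ⟨x, rfl⟩ := hm.1
      have h3 := h.1.payoff_le_objective2 hτ x.1 x.2
      simp only [dualPayoff1_eq, mul_neg, Finset.sum_neg_distrib]
      simp only [objective2] at h3
      linarith
    simp only [objective2] at hZ
    simp only [mul_neg, Finset.sum_neg_distrib, hZ]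
    linarith

end Game

end BayesGame

end

/-! ### The theorem, for both linear programs -/

open BayesGame Game in
theorem mainTheorem1 {K L A B : Type*} [Fintype K] [Fintype L] [Fintype A] [Fintype B]
    [DecidableEq K] [DecidableEq L] [Nonempty A] [Nonempty B]
    (g : Game K L A B) (n : ℕ) (hn : 1 ≤ n) (lam : ℝ) (hlam : lam ∈ Set.Ioc (0 : ℝ) 1)
    (p : stdSimplex ℝ K) (q : stdSimplex ℝ L) :
    ∃ v : ℝ, IsGameValue (g.payoff n lam p q) v ∧
      -- player 1's linear program
      IsGreatest {c | ∃ R U, g.Feasible1 n lam p R U ∧ c = objective1 q U} v ∧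
      (∀ R U, g.IsOptimal1 n lam p q R U →
        (∃ σ, g.Induces1 n p R σ) ∧
        (∀ σ, g.Induces1 n p R σ →
          IsSecurity1 (g.payoff n lam p q) σ ∧
          (∀ l, ∃ m, g.IsAlpha n lam p σ l m ∧ U 0 (Info.start l) ≤ m ∧
            (0 < q l → U 0 (Info.start l) = m)) ∧
          ∃ U', g.IsOptimal1 n lam p q R U' ∧ ∀ l, g.IsAlpha n lam p σ l (U' 0 (Info.start l))) ∧
        g.IsSpecialNu n lam p q v (fun l => -U 0 (Info.start l))) ∧
      -- player 2's linear program
      IsLeast {c | ∃ S Z, g.Feasible2 n lam q S Z ∧ c = objective2 p Z} v ∧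
      (∀ S Z, g.IsOptimal2 n lam p q S Z →
        (∃ τ, g.Induces2 n q S τ) ∧
        (∀ τ, g.Induces2 n q S τ →
          IsSecurity2 (g.payoff n lam p q) τ ∧
          (∀ k, ∃ m, g.IsBeta n lam q τ k m ∧ m ≤ Z 0 (Info.start k) ∧
            (0 < p k → Z 0 (Info.start k) = m)) ∧
          ∃ Z', g.IsOptimal2 n lam p q S Z' ∧ ∀ k, g.IsBeta n lam q τ k (Z' 0 (Info.start k))) ∧
        g.IsSpecialMu n lam p q v (fun k => -Z 0 (Info.start k))) := by
  obtain ⟨v, hv⟩ := g.exists_isGameValue_payoff n lam p q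
  have h1 := isGreatest_objective1 hv
  have h2 := isLeast_objective2 hv
  refine ⟨v, hv, h1, fun R U h => ?_, h2, fun S Z h => ?_⟩
  · have hU := h.objective1_eq h1
    obtain ⟨σ, hσ⟩ := h.1.isPlan.exists_induces
    exact ⟨⟨σ, induces1_iff.2 hσ⟩, fun σ hσ => ⟨h.isSecurity1 hσ hv.1 hU, h.exists_isAlpha hσ⟩,
      h.isSpecialNu hv.1 hU⟩
  · have hZ := h.objective2_eq h2
    obtain ⟨τ, hτ⟩ := h.1.isPlan.exists_induces
    exact ⟨⟨τ, induces2_iff.2 hτ⟩, fun τ hτ => ⟨h.isSecurity2 hτ hv.2 hZ, h.exists_isBeta hτ⟩,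
      h.isSpecialMu hv.2 hZ⟩
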